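/- Let $k\ge 2$ be an integer and let $\alpha\in\mathbb C$ with $0<|\alpha|<2$. For a bounded function $f:\mathbb R\to\mathbb C$ and an integer $N\ge 2$ put $$S_{f}(k,\alpha;N)=\sum_{\substack{n\ k\text{-free}\\ p\mid n\Rightarrow p\le N}} f\!\left(\frac{\log n}{\log N}\right)\frac{\alpha^{\Omega(n)}}{n},$$ where $n\ge 1$ is $k$-free if $p^k\nmid n$ for every prime $p$, and $\Omega(n)$ is the number of prime factors of $n$ counted with multiplicity. Let $$\varphi^{(\alpha)}(\lambda)=\exp\left\{\alpha\int_0^1\frac{e^{i\lambda v}-1}{v}\,dv\right\},\qquad R(N)=\frac{\log N}{\log\log N},$$ let $\hat f$ denote the Fourier transform of $f$ (in the sense of tempered distributions, normalized so that $\hat f(\lambda)=\frac1{2\pi}\int e^{-i\lambda x}f(x)\,dx$ for integrable $f$), and let $\mathcal S_\eta$ be the set of all $f:\mathbb R\to\mathbb C$ for which $\hat f$ is a function with $|\hat f(\lambda)|\le C_0/(1+|\lambda|^\eta)$ for all $\lambda\in\mathbb R$, for some $C_0>0$. Then there is a constant $C=C(k,\alpha)\ne0$ such that for every $\eta>|\alpha|-\Re\alpha$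 and every bounded $f\in\mathcal S_\eta$ (assumed continuous if $\eta>1$) the numbers $\varepsilon_N$ given by $$S_{f}(k,\alpha;N)=C\,(\log N)^\alpha\left(\int_{|\lambda|\le R(N)}\varphi^{(\alpha)}(\lambda)\hat f(\lambda)\,d\lambda+\varepsilon_N\right)\qquad(N\ge2)$$ satisfy, as $N\to\infty$, with implied constants that may depend on $k,\alpha,\eta,f$: $$\varepsilon_N=\begin{cases}O\!\left(\dfrac{\log\log N}{\log N}\right)&\text{if }\eta>|\alpha|-\Re\alpha+2,\\[2ex] O\!\left(\dfrac{(\log\log N)^{\eta-1}}{(\log N)^{\eta-(|\alpha|-\Re\alpha+1)}}\right)&\text{if }|\alpha|-\Re\alpha<\eta\le|\alpha|-\Re\alpha+2.\end{cases}$$ Moreover, $\varepsilon_N\to0$ whenever $\eta>|\alpha|-\Re\alpha+1$. -/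

import Mathlib

open scoped SchwartzMap

noncomputable section

/-- The positive integers that are `k`-free (`p ^ k ∤ n` for every prime `p`) and all of whose
prime factors are at most `N`. -/
def smoothKFree (k N : ℕ) : Set ℕ :=
  {n | n ≠ 0 ∧ (∀ p : ℕ, p.Prime → ¬ p ^ k ∣ n) ∧ ∀ p : ℕ, p.Prime → p ∣ n → p ≤ N}

/-- There are only finitely many such integers, so that the finite sum `smoothSum` below ranges
over all of them. -/
theorem smoothKFree_finite (k N : ℕ) : (smoothKFree k N).Finite := by
  have h0 : (primorial N) ^ k ≠ 0 := pow_ne_zero _ (primorial_pos N).ne'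
  refine (((primorial N) ^ k).divisors.finite_toSet).subset ?_
  rintro n ⟨hn, hk, hN⟩
  simp only [Finset.mem_coe, Nat.mem_divisors]
  refine ⟨?_, h0⟩
  rw [← Nat.factorization_prime_le_iff_dvd hn h0]
  intro p hp
  by_cases hpn : p ∣ n
  · have hlt : n.factorization p ≤ k := by
      by_contra! h
      exact hk p hp ((hp.pow_dvd_iff_le_factorization hn).2 h.le)
    have hpd : p ∣ primorial N :=
      Finset.dvd_prod_of_mem (fun q => q)
        (Finset.mem_filter.2 ⟨Finset.mem_range.2 (Nat.lt_succ_of_le (hN p hp hpn)), hp⟩)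
    exact hlt.trans ((hp.pow_dvd_iff_le_factorization h0).1 (pow_dvd_pow_of_dvd hpd k))
  · simp [Nat.factorization_eq_zero_of_not_dvd hpn]

/-- The sum `∑ f (log n / log N) * α ^ Ω(n) / n` over the `k`-free integers `n` with no prime
factor exceeding `N`; `Ω(n)` is the number of prime factors of `n` counted with multiplicity. -/
def smoothSum (f : ℝ → ℂ) (k : ℕ) (α : ℂ) (N : ℕ) : ℂ :=
  ∑ᶠ n ∈ smoothKFree k N,
    f (Real.log n / Real.log N) * (α ^ (ArithmeticFunction.cardFactors n) / (n : ℂ))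

/-- `φ^(α)(t) = exp (α ∫₀¹ (e^{itv} - 1) / v dv)`. -/
def dickmanChar (α : ℂ) (t : ℝ) : ℂ :=
  Complex.exp (α * ∫ v in (0 : ℝ)..1, (Complex.exp (Complex.I * t * v) - 1) / (v : ℂ))

/-- The Fourier integral `(1 / 2π) ∫ e^{-itx} ψ(t) dt`, in the normalization in which the
inversion formula reads `ψ(t) = ∫ e^{itx} ψ̂(x) dx`. -/
def fourierHat (ψ : ℝ → ℂ) (x : ℝ) : ℂ :=
  (2 * Real.pi : ℂ)⁻¹ * ∫ t : ℝ, Complex.exp (-(Complex.I * t * x)) * ψ t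

/-- The function `g` is the Fourier transform of the function `f`, in the sense of tempered
distributions: `∫ g ψ = ∫ f ψ̂` for all Schwartz functions `ψ`, both integrals being absolutely
convergent. For integrable `f` this is the function `fourierHat f`, up to almost everywhere
equality. -/
def IsFourierTransform (f g : ℝ → ℂ) : Prop :=
  ∀ ψ : 𝓢(ℝ, ℂ),
    MeasureTheory.Integrable (fun t : ℝ => g t * ψ t) ∧
    MeasureTheory.Integrable (fun x : ℝ => f x * fourierHat ψ x) ∧
    ∫ t : ℝ, g t * ψ t = ∫ x : ℝ, f x * fourierHat ψ x

/-- The space `𝓢_η(ℝ)` of the functions `f : ℝ → ℂ` whose Fourier transform is a function bounded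
by a constant multiple of `1 / (1 + |t| ^ η)`. -/
def fourierDecay (η : ℝ) : Set (ℝ → ℂ) :=
  {f | ∃ g : ℝ → ℂ, IsFourierTransform f g ∧
    ∃ C : ℝ, 0 < C ∧ ∀ t : ℝ, ‖g t‖ ≤ C / (1 + |t| ^ η)}

/-- The cut-off `R(N) = log N / log log N`. -/
def cutoff (N : ℕ) : ℝ := Real.log N / Real.log (Real.log N)

end

/-!
Fourier inversion `f x = ∫ e^{itx} fhat(t) dt` turns the sum `S_f` into `∫ fhat(t) E(t / log N) dt`,
where `E(t) = ∏_{p ≤ N} ∑_{j < k} (α p^{it} / p) ^ j` is the Euler product of the sum twisted by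
`n ^ {it}`. Mertens' theorem for `∑ p^{it} / p` yields
`E(t) = C (log N)^α φ(t log N) exp (O(1 / log N + |t| log log N))`, where `C` gathers the limits of
the factors with `p ^ {it}` replaced by `1`. Split the integral at `|t| = R(N)`. Inside, the
asymptotic formula applies and its error, weighted by `|φ(t)| ≪ |t|^{-Re α}` and
`fhat(t) ≪ |t|^{-η}`, is integrated. Outside, only the trivial bound `|E| ≪ (log N)^{|α|}` is used.
For `η ≤ 1` the function `fhat` need not be integrable; the sum and the truncated integral are then
each bounded separately, by no more than the claimed error.
-/


open MeasureTheory Filter Topology Asymptotics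

section Mertens

theorem summable_log_div_sq : Summable fun n : ℕ => Real.log n / (n : ℝ) ^ 2 := by
  have hmajorant : Summable fun n : ℕ => 2 * (1 / (n : ℝ) ^ (3 / 2 : ℝ)) :=
    (Real.summable_one_div_nat_rpow.2 (by norm_num)).mul_left 2
  refine hmajorant.of_nonneg_of_le (fun n => by positivity) fun n => ?_
  rcases Nat.eq_zero_or_pos n with rfl | hn
  · simp
  have hn' : (0 : ℝ) < n := by exact_mod_cast hn
  have hsq : (n : ℝ) ^ 2 = (n : ℝ) ^ (1 / 2 : ℝ) * (n : ℝ) ^ (3 / 2 : ℝ) := by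
    rw [← Real.rpow_add hn', ← Real.rpow_natCast]; norm_num
  rw [hsq, div_le_iff₀ (by positivity)]
  calc Real.log n ≤ (n : ℝ) ^ (1 / 2 : ℝ) / (1 / 2) := Real.log_le_rpow_div hn'.le (by norm_num)
    _ = _ := by field_simp

theorem log_factorial_eq_sum_primesLE (n : ℕ) :
    Real.log n.factorial = ∑ p ∈ n.primesLE, (padicValNat p n.factorial : ℝ) * Real.log p := by
  rw [Real.log_nat_eq_sum_factorization, Finsupp.sum_of_support_subset (s := n.primesLE)]
  · refine Finset.sum_congr rfl fun p hp => ?_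
    rw [Nat.factorization_def _ (Nat.prime_of_mem_primesLE hp)]
  · intro p hp
    simp only [Nat.support_factorization, Nat.mem_primeFactors] at hp
    exact Nat.mem_primesLE.2 ⟨hp.1.dvd_factorial.1 hp.2.1, hp.1⟩
  · simp

theorem div_sub_one_le_padicValNat_factorial {p : ℕ} (hp : p.Prime) (n : ℕ) :
    (n : ℝ) / p - 1 ≤ padicValNat p n.factorial := by
  have := Fact.mk hp
  have hdiv : n / p ≤ padicValNat p n.factorial := by
    rw [← padicValNat_mul_div_factorial, padicValNat_factorial_mul]
    omega
  have hfloor : (n : ℝ) / p < ((n / p : ℕ) : ℝ) + 1 := by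
    rw [← Nat.floor_div_eq_div (K := ℝ)]; exact Nat.lt_floor_add_one _
  have : ((n / p : ℕ) : ℝ) ≤ padicValNat p n.factorial := by exact_mod_cast hdiv
  linarith

theorem padicValNat_factorial_le_mul {p : ℕ} (hp : p.Prime) (n : ℕ) :
    (padicValNat p n.factorial : ℝ) ≤ n * (1 / p + 2 / (p : ℝ) ^ 2) := by
  have := Fact.mk hp
  have hp2 : (2 : ℝ) ≤ p := by exact_mod_cast hp.two_le
  have hlegendre : (padicValNat p n.factorial : ℝ) * (p - 1) ≤ n := by
    have h : (p - 1) * padicValNat p n.factorial ≤ n :=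
      sub_one_mul_padicValNat_factorial (p := p) n ▸ Nat.sub_le _ _
    rw [mul_comm, ← Nat.cast_one, ← Nat.cast_sub hp.one_le]
    exact_mod_cast h
  have hgeom : (1 : ℝ) / (p - 1) ≤ 1 / p + 2 / (p : ℝ) ^ 2 := by
    rw [div_le_iff₀ (by linarith)]
    field_simp
    nlinarith
  calc (padicValNat p n.factorial : ℝ) ≤ n / (p - 1) := by rwa [le_div_iff₀ (by linarith)]
    _ = n * (1 / (p - 1)) := by rw [mul_one_div]
    _ ≤ _ := by gcongr

theorem mul_sum_log_div_prime_le_log_factorial (n : ℕ) :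
    n * (∑ p ∈ n.primesLE, Real.log p / p - Real.log 4) ≤ Real.log n.factorial := by
  have hθ : ∑ p ∈ n.primesLE, Real.log p ≤ Real.log 4 * n := by
    rw [← Chebyshev.theta_eq_sum_primesLE_log]
    exact Chebyshev.theta_le_log4_mul_x n.cast_nonneg
  have hterms : ∑ p ∈ n.primesLE, ((n : ℝ) / p - 1) * Real.log p ≤ Real.log n.factorial := by
    rw [log_factorial_eq_sum_primesLE]
    refine Finset.sum_le_sum fun p hp => ?_
    gcongr
    exact div_sub_one_le_padicValNat_factorial (Nat.prime_of_mem_primesLE hp) n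
  have hsplit : ∑ p ∈ n.primesLE, ((n : ℝ) / p - 1) * Real.log p =
      n * ∑ p ∈ n.primesLE, Real.log p / p - ∑ p ∈ n.primesLE, Real.log p := by
    rw [Finset.mul_sum, ← Finset.sum_sub_distrib]
    exact Finset.sum_congr rfl fun p _ => by ring
  linarith

theorem log_factorial_le_mul_sum_log_div_prime (n : ℕ) :
    Real.log n.factorial ≤
      n * (∑ p ∈ n.primesLE, Real.log p / p + 2 * ∑' m : ℕ, Real.log m / (m : ℝ) ^ 2) := by
  calc Real.log n.factorial
      ≤ ∑ p ∈ n.primesLE, n * (1 / p + 2 / (p : ℝ) ^ 2) * Real.log p := by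
        rw [log_factorial_eq_sum_primesLE]
        refine Finset.sum_le_sum fun p hp => ?_
        gcongr
        exact padicValNat_factorial_le_mul (Nat.prime_of_mem_primesLE hp) n
    _ = n * (∑ p ∈ n.primesLE, Real.log p / p +
          2 * ∑ p ∈ n.primesLE, Real.log p / (p : ℝ) ^ 2) := by
        rw [Finset.mul_sum, ← Finset.sum_add_distrib, Finset.mul_sum]
        exact Finset.sum_congr rfl fun p _ => by ring
    _ ≤ _ := by
        gcongr
        exact summable_log_div_sq.sum_le_tsum _ fun i _ => by positivity

/-- The error term `∑ p ≤ x, log p / p - log x` in the first theorem of Mertens. -/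
noncomputable def mertensRemainder (x : ℝ) : ℝ := ∑ p ∈ ⌊x⌋₊.primesLE, Real.log p / p - Real.log x

theorem exists_abs_mertensRemainder_natCast_le :
    ∃ M : ℝ, ∀ n : ℕ, n ≠ 0 → |mertensRemainder n| ≤ M := by
  set K := 2 * ∑' n : ℕ, Real.log n / (n : ℝ) ^ 2
  have hK : 0 ≤ K := mul_nonneg (by norm_num) (tsum_nonneg fun n => by positivity)
  refine ⟨1 + K + Real.log 4, fun n hn => ?_⟩
  have hn' : (0 : ℝ) < n := by exact_mod_cast hn.pos
  have hstirling : n * (Real.log n - 1) ≤ Real.log n.factorial := by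
    have h1 := Stirling.le_log_factorial_stirling hn
    have h2 : 0 ≤ Real.log (2 * Real.pi) := Real.log_nonneg (by nlinarith [Real.pi_gt_three])
    linarith [Real.log_natCast_nonneg n]
  have hpow : Real.log n.factorial ≤ n * Real.log n := by
    rw [← Real.log_pow]
    refine Real.log_le_log (by exact_mod_cast n.factorial_pos) ?_
    exact_mod_cast n.factorial_le_pow
  have hupper := le_of_mul_le_mul_left
    ((mul_sum_log_div_prime_le_log_factorial n).trans hpow) hn'
  have hlower := le_of_mul_le_mul_left
    (hstirling.trans (log_factorial_le_mul_sum_log_div_prime n)) hn'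
  have h4 : 0 ≤ Real.log 4 := Real.log_nonneg (by norm_num)
  rw [mertensRemainder, Nat.floor_natCast, abs_le]
  constructor <;> linarith

theorem exists_abs_mertensRemainder_le :
    ∃ M : ℝ, 0 ≤ M ∧ ∀ x : ℝ, 1 ≤ x → |mertensRemainder x| ≤ M := by
  obtain ⟨M, hM⟩ := exists_abs_mertensRemainder_natCast_le
  have hM0 : 0 ≤ M := (abs_nonneg _).trans (hM 1 one_ne_zero)
  refine ⟨M + Real.log 2, by positivity, fun x hx => ?_⟩
  have hfloor : 1 ≤ ⌊x⌋₊ := (Nat.one_le_floor_iff x).2 hx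
  have hfloor' : (1 : ℝ) ≤ ⌊x⌋₊ := by exact_mod_cast hfloor
  have hlow : Real.log ⌊x⌋₊ ≤ Real.log x :=
    Real.log_le_log (by linarith) (Nat.floor_le (by linarith))
  have hhigh : Real.log x ≤ Real.log 2 + Real.log ⌊x⌋₊ := by
    rw [← Real.log_mul (by norm_num) (by linarith)]
    exact Real.log_le_log (by linarith) (by linarith [Nat.lt_floor_add_one x])
  have hnat := abs_le.1 (hM _ (by omega : ⌊x⌋₊ ≠ 0))
  rw [mertensRemainder, Nat.floor_natCast] at hnat
  rw [mertensRemainder, abs_le]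
  constructor <;> linarith

/-- `log p / p` at the primes `p`, extended by zero: the coefficients of the first theorem of
Mertens, in the complex form used for Abel summation. -/
noncomputable def primeLogWeight (n : ℕ) : ℂ := if n.Prime then Real.log n / n else 0

theorem sum_Icc_primeLogWeight (x : ℝ) :
    ∑ n ∈ Finset.Icc 0 ⌊x⌋₊, primeLogWeight n = Real.log x + mertensRemainder x := by
  simp [primeLogWeight, mertensRemainder, Nat.primesLE_eq_filter_Icc_zero, Finset.sum_filter,
    apply_ite Complex.ofReal]

variable {a b : ℝ} {W W' : ℝ → ℂ}

theorem integral_mul_log_eq_sub_integral_div (ha : 0 < a) (hab : a ≤ b)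
    (hW : ∀ x ∈ Set.Icc a b, HasDerivAt W (W' x) x) (hW' : ContinuousOn W' (Set.Icc a b)) :
    ∫ x in a..b, W' x * Real.log x =
      W b * Real.log b - W a * Real.log a - ∫ x in a..b, W x / x := by
  rw [← Set.uIcc_of_le hab] at hW hW'
  have hpos (x : ℝ) (hx : x ∈ Set.uIcc a b) : 0 < x := ha.trans_le (Set.uIcc_of_le hab ▸ hx).1
  have hlog (x : ℝ) (hx : x ∈ Set.uIcc a b) :
      HasDerivAt (fun y : ℝ => (Real.log y : ℂ)) (x : ℂ)⁻¹ x := by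
    simpa only [Complex.ofReal_inv] using (Real.hasDerivAt_log (hpos x hx).ne').ofReal_comp
  have hinv : ContinuousOn (fun y : ℝ => (y : ℂ)⁻¹) (Set.uIcc a b) :=
    Complex.continuous_ofReal.continuousOn.inv₀ fun x hx =>
      Complex.ofReal_ne_zero.2 (hpos x hx).ne'
  simp only [div_eq_mul_inv, intervalIntegral.integral_mul_deriv_eq_deriv_mul hW hlog
    hW'.intervalIntegrable hinv.intervalIntegrable, sub_sub_cancel]

theorem intervalIntegrable_mul_log (ha : 0 < a) (hab : a ≤ b)
    (hW' : ContinuousOn W' (Set.Icc a b)) :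
    IntervalIntegrable (fun x => W' x * Real.log x) volume a b := by
  refine ContinuousOn.intervalIntegrable_of_Icc hab (hW'.mul ?_)
  exact Complex.continuous_ofReal.comp_continuousOn
    (Real.continuousOn_log.mono fun x hx => (ha.trans_le hx.1).ne')

theorem intervalIntegrable_mul_mertensRemainder (ha : 0 < a) (hab : a ≤ b)
    (hW' : ContinuousOn W' (Set.Icc a b)) :
    IntervalIntegrable (fun x => W' x * mertensRemainder x) volume a b := by
  have hpartial : IntervalIntegrable
      (fun x => W' x * ∑ n ∈ Finset.Icc 0 ⌊x⌋₊, primeLogWeight n) volume a b :=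
    (intervalIntegrable_iff_integrableOn_Icc_of_le hab).2
      (integrableOn_mul_sum_Icc primeLogWeight ha.le (m := 0) hW'.integrableOn_Icc)
  simpa [sum_Icc_primeLogWeight, mul_add] using
    hpartial.sub (intervalIntegrable_mul_log ha hab hW')

theorem sum_prime_mul_log_div_eq_integral_add (ha : 0 < a) (hab : a ≤ b)
    (hW : ∀ x ∈ Set.Icc a b, HasDerivAt W (W' x) x) (hW' : ContinuousOn W' (Set.Icc a b)) :
    ∑ p ∈ Finset.Ioc ⌊a⌋₊ ⌊b⌋₊ with p.Prime, W p * (Real.log p / p) =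
      (∫ x in a..b, W x / x) + (W b * mertensRemainder b - W a * mertensRemainder a) -
        ∫ x in a..b, W' x * mertensRemainder x := by
  have hderiv (x : ℝ) (hx : x ∈ Set.Icc a b) : deriv W x = W' x := (hW x hx).deriv
  have habel := sum_mul_eq_sub_sub_integral_mul primeLogWeight ha.le hab
    (fun t ht => (hW t ht).differentiableAt)
    (hW'.integrableOn_Icc.congr_fun (fun x hx => (hderiv x hx).symm) measurableSet_Icc)
  have hsum : ∑ p ∈ Finset.Ioc ⌊a⌋₊ ⌊b⌋₊ with p.Prime, W p * (Real.log p / p) =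
      ∑ p ∈ Finset.Ioc ⌊a⌋₊ ⌊b⌋₊, W p * primeLogWeight p := by
    simp only [primeLogWeight, Finset.sum_filter, mul_ite, mul_zero]
  have hintegral : ∫ t in Set.Ioc a b, deriv W t * (Real.log t + mertensRemainder t) =
      (∫ x in a..b, W' x * Real.log x) + ∫ x in a..b, W' x * mertensRemainder x := by
    rw [← intervalIntegral.integral_add (intervalIntegrable_mul_log ha hab hW')
      (intervalIntegrable_mul_mertensRemainder ha hab hW'), intervalIntegral.integral_of_le hab]
    refine setIntegral_congr_fun measurableSet_Ioc fun x hx => ?_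
    simp only [hderiv x (Set.Ioc_subset_Icc_self hx), mul_add]
  simp only [sum_Icc_primeLogWeight] at habel
  rw [hsum, habel, hintegral, integral_mul_log_eq_sub_integral_div ha hab hW hW']
  ring

theorem exists_norm_sum_prime_mul_log_div_sub_integral_le :
    ∃ M : ℝ, 0 ≤ M ∧ ∀ (a b : ℝ) (W W' : ℝ → ℂ), 1 ≤ a → a ≤ b →
      (∀ x ∈ Set.Icc a b, HasDerivAt W (W' x) x) → ContinuousOn W' (Set.Icc a b) →
      ‖∑ p ∈ Finset.Ioc ⌊a⌋₊ ⌊b⌋₊ with p.Prime, W p * (Real.log p / p) - ∫ x in a..b, W x / x‖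
        ≤ M * (‖W a‖ + ‖W b‖ + ∫ x in a..b, ‖W' x‖) := by
  obtain ⟨M, hM0, hM⟩ := exists_abs_mertensRemainder_le
  refine ⟨M, hM0, fun a b W W' ha hab hW hW' => ?_⟩
  have hsum := sum_prime_mul_log_div_eq_integral_add (by linarith) hab hW hW'
  have hmul (z : ℂ) (x : ℝ) (hx : 1 ≤ x) : ‖z * mertensRemainder x‖ ≤ M * ‖z‖ := by
    rw [norm_mul, Complex.norm_real, mul_comm]
    gcongr
    exact hM x hx
  have hint : ‖∫ x in a..b, W' x * mertensRemainder x‖ ≤ M * ∫ x in a..b, ‖W' x‖ := by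
    rw [← intervalIntegral.integral_const_mul]
    refine intervalIntegral.norm_integral_le_of_norm_le hab
      (Eventually.of_forall fun x hx => hmul _ x (ha.trans hx.1.le)) ?_
    exact ((hW'.norm.const_mul M).mono (Set.uIcc_of_le hab).subset).intervalIntegrable
  calc _ = ‖W b * mertensRemainder b - W a * mertensRemainder a -
        ∫ x in a..b, W' x * mertensRemainder x‖ := by rw [hsum]; ring_nf
    _ ≤ ‖W b * mertensRemainder b‖ + ‖W a * mertensRemainder a‖ +
        ‖∫ x in a..b, W' x * mertensRemainder x‖ := norm_sub_le_of_le (norm_sub_le _ _) le_rfl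
    _ ≤ _ := by linarith [hmul (W b) b (ha.trans hab), hmul (W a) a ha]

theorem exists_norm_sum_prime_comp_log_sub_integral_le :
    ∃ M : ℝ, 0 ≤ M ∧ ∀ (m n : ℕ) (w w' : ℝ → ℂ), m ≠ 0 → m ≤ n →
      (∀ u ∈ Set.Icc (Real.log m) (Real.log n), HasDerivAt w (w' u) u) →
      ContinuousOn w' (Set.Icc (Real.log m) (Real.log n)) →
      ‖∑ p ∈ Finset.Ioc m n with p.Prime, w (Real.log p) * (Real.log p / p) -
          ∫ u in Real.log m..Real.log n, w u‖ ≤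
        M * (‖w (Real.log m)‖ + ‖w (Real.log n)‖ + ∫ u in Real.log m..Real.log n, ‖w' u‖) := by
  obtain ⟨M, hM0, hM⟩ := exists_norm_sum_prime_mul_log_div_sub_integral_le
  refine ⟨M, hM0, fun m n w w' hm hmn hw hw' => ?_⟩
  have hm1 : (1 : ℝ) ≤ m := by exact_mod_cast Nat.one_le_iff_ne_zero.2 hm
  have hmn' : (m : ℝ) ≤ n := by exact_mod_cast hmn
  have hpos (x : ℝ) (hx : x ∈ Set.Icc (m : ℝ) n) : 0 < x := by linarith [hx.1]
  have hlog (x : ℝ) (hx : x ∈ Set.Icc (m : ℝ) n) : HasDerivAt Real.log x⁻¹ x :=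
    Real.hasDerivAt_log (hpos x hx).ne'
  have hlogc : ContinuousOn Real.log (Set.Icc (m : ℝ) n) :=
    fun x hx => (hlog x hx).continuousAt.continuousWithinAt
  have hinv : ContinuousOn (fun x : ℝ => x⁻¹) (Set.Icc (m : ℝ) n) :=
    continuousOn_inv₀.mono fun x hx => (hpos x hx).ne'
  have hmaps : Set.MapsTo Real.log (Set.Icc (m : ℝ) n) (Set.Icc (Real.log m) (Real.log n)) :=
    fun x hx => ⟨Real.log_le_log (by linarith) hx.1, Real.log_le_log (hpos x hx) hx.2⟩
  have huIcc : Set.uIcc (m : ℝ) n = Set.Icc (m : ℝ) n := Set.uIcc_of_le hmn'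
  have hsubst {E : Type} [NormedAddCommGroup E] [NormedSpace ℝ E] {g : ℝ → E}
      (hg : ContinuousOn g (Set.Icc (Real.log m) (Real.log n))) :
      ∫ x in (m : ℝ)..n, x⁻¹ • g (Real.log x) = ∫ u in Real.log m..Real.log n, g u :=
    intervalIntegral.integral_deriv_smul_comp' (fun x hx => hlog x (huIcc ▸ hx)) (huIcc ▸ hinv)
      (hg.mono (huIcc ▸ hmaps.image_subset))
  have key := hM m n (fun x => w (Real.log x)) (fun x => x⁻¹ • w' (Real.log x)) hm1 hmn'
    (fun x hx => (hw _ (hmaps hx)).scomp x (hlog x hx)) (hinv.smul (hw'.comp hlogc hmaps))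
  have hmain : ∫ x in (m : ℝ)..n, w (Real.log x) / x = ∫ u in Real.log m..Real.log n, w u := by
    rw [← hsubst fun u hu => (hw u hu).continuousAt.continuousWithinAt]
    simp only [Complex.real_smul, Complex.ofReal_inv, div_eq_inv_mul]
  have hvar : ∫ x in (m : ℝ)..n, ‖x⁻¹ • w' (Real.log x)‖ =
      ∫ u in Real.log m..Real.log n, ‖w' u‖ := by
    rw [← hsubst hw'.norm]
    refine intervalIntegral.integral_congr fun x hx => ?_
    simp only [norm_smul, smul_eq_mul, norm_inv, Real.norm_of_nonneg (hpos x (huIcc ▸ hx)).le]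
  simpa only [Nat.floor_natCast, hmain, hvar] using key

theorem sum_primesLE_sub_sum_primesLE {E : Type*} [AddCommGroup E] (g : ℕ → E) {m n : ℕ}
    (h : m ≤ n) :
    ∑ p ∈ n.primesLE, g p - ∑ p ∈ m.primesLE, g p = ∑ p ∈ Finset.Ioc m n with p.Prime, g p := by
  rw [sub_eq_iff_eq_add', ← Finset.sum_union]
  · refine Finset.sum_congr ?_ fun _ _ => rfl
    ext p
    simp only [Nat.mem_primesLE, Finset.mem_union, Finset.mem_filter, Finset.mem_Ioc]
    grind
  · rw [Finset.disjoint_left]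
    intro p hp hp'
    simp only [Nat.mem_primesLE, Finset.mem_filter, Finset.mem_Ioc] at hp hp'
    omega

/-- The difference `∑ p ≤ n, 1 / p - log log n`, which converges by the second theorem of
Mertens. -/
noncomputable def primeReciprocalDefect (n : ℕ) : ℝ :=
  ∑ p ∈ n.primesLE, 1 / (p : ℝ) - Real.log (Real.log n)

/-- The constant `lim (∑ p ≤ n, 1 / p - log log n)` of Meissel and Mertens. -/
noncomputable def meisselMertens : ℝ := limUnder atTop primeReciprocalDefect

theorem exists_abs_primeReciprocalDefect_sub_le :
    ∃ K : ℝ, ∀ m n : ℕ, 2 ≤ m → m ≤ n →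
      |primeReciprocalDefect n - primeReciprocalDefect m| ≤ K / Real.log m := by
  obtain ⟨M, -, hM⟩ := exists_norm_sum_prime_comp_log_sub_integral_le
  refine ⟨2 * M, fun m n hm hmn => ?_⟩
  have hm1 : (1 : ℝ) < m := by exact_mod_cast hm
  have hlm : 0 < Real.log m := Real.log_pos hm1
  have hmn' : Real.log m ≤ Real.log n := Real.log_le_log (by linarith) (by exact_mod_cast hmn)
  have hln : 0 < Real.log n := hlm.trans_le hmn'
  have hne (u : ℝ) (hu : u ∈ Set.Icc (Real.log m) (Real.log n)) : u ≠ 0 :=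
    (hlm.trans_le hu.1).ne'
  have hc : ContinuousOn (fun u : ℝ => (u ^ 2)⁻¹) (Set.Icc (Real.log m) (Real.log n)) :=
    (continuousOn_pow 2).inv₀ fun u hu => pow_ne_zero 2 (hne u hu)
  have key := hM m n (fun u => ((u⁻¹ : ℝ) : ℂ)) (fun u => ((-(u ^ 2)⁻¹ : ℝ) : ℂ)) (by omega) hmn
    (fun u hu => (hasDerivAt_inv (hne u hu)).ofReal_comp)
    (Complex.continuous_ofReal.comp_continuousOn hc.neg)
  have hsum : ∑ p ∈ Finset.Ioc m n with p.Prime,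
      ((Real.log p)⁻¹ : ℝ) * ((Real.log p : ℂ) / p) =
      ((∑ p ∈ n.primesLE, 1 / (p : ℝ) - ∑ p ∈ m.primesLE, 1 / (p : ℝ) : ℝ) : ℂ) := by
    rw [sum_primesLE_sub_sum_primesLE _ hmn, Complex.ofReal_sum]
    refine Finset.sum_congr rfl fun p hp => ?_
    have hlp : (Real.log p : ℂ) ≠ 0 := by
      exact_mod_cast (Real.log_pos (by exact_mod_cast (Finset.mem_filter.1 hp).2.one_lt)).ne'
    rw [Complex.ofReal_inv, Complex.ofReal_div, Complex.ofReal_one, Complex.ofReal_natCast]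
    field_simp
  have hmain : ∫ u in Real.log m..Real.log n, u⁻¹ =
      Real.log (Real.log n) - Real.log (Real.log m) := by
    rw [integral_inv_of_pos hlm hln, Real.log_div hln.ne' hlm.ne']
  have hvar : ∫ u in Real.log m..Real.log n, (u ^ 2)⁻¹ = (Real.log m)⁻¹ - (Real.log n)⁻¹ := by
    rw [← Set.uIcc_of_le hmn'] at hne hc
    rw [intervalIntegral.integral_eq_sub_of_hasDerivAt (f := fun u => -u⁻¹)
      (fun u hu => (hasDerivAt_inv (hne u hu)).neg.congr_deriv (neg_neg _)) hc.intervalIntegrable]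
    ring
  rw [hsum, intervalIntegral.integral_ofReal, hmain, ← Complex.ofReal_sub] at key
  simp only [Complex.norm_real, norm_neg, norm_inv, norm_pow, Real.norm_eq_abs, sq_abs, hvar,
    abs_of_pos hlm, abs_of_pos hln] at key
  calc |primeReciprocalDefect n - primeReciprocalDefect m| = _ := by
        simp only [primeReciprocalDefect]; congr 1; ring
    _ ≤ _ := key
    _ = 2 * M / Real.log m := by ring

theorem exists_abs_primeReciprocalDefect_sub_meisselMertens_le :
    ∃ K : ℝ, ∀ n : ℕ, 2 ≤ n → |primeReciprocalDefect n - meisselMertens| ≤ K / Real.log n := by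
  obtain ⟨K, hK⟩ := exists_abs_primeReciprocalDefect_sub_le
  have hrate : Tendsto (fun n : ℕ => K / Real.log ((n + 2 : ℕ) : ℝ)) atTop (𝓝 0) :=
    tendsto_const_nhds.div_atTop (Real.tendsto_log_atTop.comp
      (tendsto_natCast_atTop_atTop.comp (tendsto_add_atTop_nat 2)))
  have hcauchy : CauchySeq fun n => primeReciprocalDefect (n + 2) := by
    refine cauchySeq_of_le_tendsto_0' _ (fun n m hnm => ?_) hrate
    rw [dist_comm, Real.dist_eq]
    exact hK (n + 2) (m + 2) (by omega) (by omega)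
  have hlim : Tendsto primeReciprocalDefect atTop (𝓝 meisselMertens) := by
    obtain ⟨B, hB⟩ := cauchySeq_tendsto_of_complete hcauchy
    exact tendsto_nhds_limUnder ⟨B, (tendsto_add_atTop_iff_nat 2).1 hB⟩
  refine ⟨K, fun n hn => ?_⟩
  rw [abs_sub_comm]
  refine le_of_tendsto (hlim.sub_const _).abs ?_
  filter_upwards [eventually_ge_atTop n] with m hm
  exact hK n m hn hm

end Mertens

section DickmanExponent

/-- The integral `∫₀¹ (e^{itv} - 1) / v dv` in the exponent of `dickmanChar`. -/
noncomputable def dickmanExponent (t : ℝ) : ℂ :=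
  ∫ v in (0 : ℝ)..1, (Complex.exp (Complex.I * t * v) - 1) / (v : ℂ)

theorem dickmanChar_eq_exp (α : ℂ) (t : ℝ) :
    dickmanChar α t = Complex.exp (α * dickmanExponent t) := rfl

/-- The continuous extension of `(e^{is} - 1) / s` to `s = 0`. -/
noncomputable def expSlope : ℝ → ℂ := dslope (fun s : ℝ => Complex.exp (Complex.I * s)) 0

theorem hasDerivAt_exp_I_mul (s : ℝ) :
    HasDerivAt (fun s : ℝ => Complex.exp (Complex.I * s)) (Complex.I * Complex.exp (Complex.I * s))
      s := by
  simpa [mul_comm] using ((hasDerivAt_id s).ofReal_comp.const_mul Complex.I).cexp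

theorem expSlope_of_ne {s : ℝ} (hs : s ≠ 0) :
    expSlope s = (Complex.exp (Complex.I * s) - 1) / s := by
  rw [expSlope, dslope_of_ne _ hs, slope_def_module]
  simp [div_eq_inv_mul]

theorem mul_expSlope (s : ℝ) : s * expSlope s = Complex.exp (Complex.I * s) - 1 := by
  rcases eq_or_ne s 0 with rfl | hs
  · simp
  · rw [expSlope_of_ne hs, mul_div_cancel₀ _ (Complex.ofReal_ne_zero.2 hs)]

theorem continuous_expSlope : Continuous expSlope := by
  rw [← continuousOn_univ, expSlope, continuousOn_dslope univ_mem]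
  exact ⟨by fun_prop, (hasDerivAt_exp_I_mul 0).differentiableAt⟩

theorem norm_expSlope_le (s : ℝ) : ‖expSlope s‖ ≤ 1 := by
  rcases eq_or_ne s 0 with rfl | hs
  · rw [expSlope, dslope_same, (hasDerivAt_exp_I_mul 0).deriv]
    simp
  · rw [expSlope_of_ne hs, norm_div, Complex.norm_real, div_le_one (by positivity)]
    exact Real.norm_exp_I_mul_ofReal_sub_one_le

/-- The derivative of `expSlope` away from zero. -/
noncomputable def expSlopeDeriv (s : ℝ) : ℂ :=
  (Complex.I * Complex.exp (Complex.I * s) - expSlope s) / s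

theorem hasDerivAt_expSlope {s : ℝ} (hs : s ≠ 0) : HasDerivAt expSlope (expSlopeDeriv s) s := by
  have hs' : (s : ℂ) ≠ 0 := Complex.ofReal_ne_zero.2 hs
  refine (((hasDerivAt_exp_I_mul s).sub_const 1).div (hasDerivAt_id s).ofReal_comp hs').congr_deriv
    ?_ |>.congr_of_eventuallyEq ?_
  · rw [expSlopeDeriv, expSlope_of_ne hs]
    simp only [id, Complex.ofReal_one, mul_one]
    field_simp
  · filter_upwards [isOpen_ne.mem_nhds hs] with x hx using expSlope_of_ne hx

theorem continuousOn_expSlopeDeriv : ContinuousOn expSlopeDeriv {0}ᶜ := by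
  have := continuous_expSlope
  exact ContinuousOn.div (by fun_prop) (by fun_prop) fun s hs => Complex.ofReal_ne_zero.2 hs

theorem norm_expSlopeDeriv_le (s : ℝ) : ‖expSlopeDeriv s‖ ≤ 2 / |s| := by
  rw [expSlopeDeriv, norm_div, Complex.norm_real, Real.norm_eq_abs]
  gcongr
  refine (norm_sub_le _ _).trans ?_
  rw [norm_mul, Complex.norm_I, Complex.norm_exp_I_mul_ofReal]
  linarith [norm_expSlope_le s]

theorem dickmanExponent_eq_integral (t : ℝ) :
    dickmanExponent t = ∫ s in (0 : ℝ)..t, expSlope s := by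
  have hscale := intervalIntegral.smul_integral_comp_mul_left (a := 0) (b := 1) expSlope t
  rw [mul_zero, mul_one] at hscale
  rw [← hscale, ← intervalIntegral.integral_smul, dickmanExponent]
  refine intervalIntegral.integral_congr_ae (Eventually.of_forall fun v hv => ?_)
  rw [Set.uIoc_of_le zero_le_one] at hv
  have hmul := mul_expSlope (t * v)
  push_cast at hmul
  rw [div_eq_iff (Complex.ofReal_ne_zero.2 hv.1.ne'), Complex.real_smul, mul_assoc Complex.I,
    ← hmul]
  ring

theorem dickmanExponent_sub_dickmanExponent (a b : ℝ) :
    dickmanExponent b - dickmanExponent a = ∫ s in a..b, expSlope s := by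
  simp only [dickmanExponent_eq_integral]
  exact intervalIntegral.integral_interval_sub_left (continuous_expSlope.intervalIntegrable _ _)
    (continuous_expSlope.intervalIntegrable _ _)

theorem integral_mul_expSlope_comp_mul (t a b : ℝ) :
    ∫ u in a..b, t * expSlope (t * u) = dickmanExponent (t * b) - dickmanExponent (t * a) := by
  rw [dickmanExponent_sub_dickmanExponent, ← intervalIntegral.smul_integral_comp_mul_left,
    intervalIntegral.integral_const_mul, Complex.real_smul]

theorem continuous_dickmanExponent : Continuous dickmanExponent := by
  rw [funext dickmanExponent_eq_integral]
  exact intervalIntegral.continuous_primitive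
    (fun a b => continuous_expSlope.intervalIntegrable a b) 0

theorem norm_dickmanExponent_le (t : ℝ) : ‖dickmanExponent t‖ ≤ |t| := by
  rw [dickmanExponent_eq_integral]
  simpa using intervalIntegral.norm_integral_le_of_norm_le_const (a := 0) (b := t)
    fun x _ => norm_expSlope_le x

theorem dickmanExponent_neg (t : ℝ) :
    dickmanExponent (-t) = (starRingEnd ℂ) (dickmanExponent t) := by
  rw [dickmanExponent, dickmanExponent, intervalIntegral.integral_of_le zero_le_one,
    intervalIntegral.integral_of_le zero_le_one, ← integral_conj]
  congr 1; ext v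
  simp only [map_div₀, map_sub, map_one, Complex.conj_ofReal, ← Complex.exp_conj, map_mul,
    Complex.conj_I]
  push_cast; ring_nf

theorem norm_integral_exp_I_mul_div_le {y : ℝ} (hy : 1 ≤ y) :
    ‖∫ s in (1 : ℝ)..y, Complex.exp (Complex.I * s) / s‖ ≤ 2 := by
  have hne (s : ℝ) (hs : s ∈ Set.uIcc 1 y) : s ≠ 0 := by
    rw [Set.uIcc_of_le hy] at hs; linarith [hs.1]
  have hsq : ContinuousOn (fun s : ℝ => (s ^ 2)⁻¹) (Set.uIcc 1 y) :=
    (continuousOn_pow 2).inv₀ fun s hs => pow_ne_zero 2 (hne s hs)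
  have hexp (s : ℝ) : HasDerivAt (fun s : ℝ => Complex.exp (Complex.I * s) / Complex.I)
      (Complex.exp (Complex.I * s)) s := by
    simpa using (hasDerivAt_exp_I_mul s).div_const Complex.I
  have hnorm (r s : ℝ) : ‖(r : ℂ) * (Complex.exp (Complex.I * s) / Complex.I)‖ = |r| := by
    rw [norm_mul, norm_div, Complex.norm_I, div_one, Complex.norm_exp_I_mul_ofReal, mul_one,
      Complex.norm_real, Real.norm_eq_abs]
  have hparts := intervalIntegral.integral_mul_deriv_eq_deriv_mul
    (fun s hs => (hasDerivAt_inv (hne s hs)).ofReal_comp) (fun s _ => hexp s)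
    (Complex.continuous_ofReal.comp_continuousOn hsq.neg).intervalIntegrable
    (Continuous.intervalIntegrable (by fun_prop) 1 y)
  have hrest : ‖∫ s in (1 : ℝ)..y,
      ((-(s ^ 2)⁻¹ : ℝ) : ℂ) * (Complex.exp (Complex.I * s) / Complex.I)‖ ≤ 1 - y⁻¹ := by
    refine (intervalIntegral.norm_integral_le_of_norm_le hy (g := fun s => (s ^ 2)⁻¹)
      (Eventually.of_forall fun s _ => ?_) hsq.intervalIntegrable).trans_eq ?_
    · rw [hnorm, abs_neg, abs_of_nonneg (by positivity)]
    · rw [intervalIntegral.integral_eq_sub_of_hasDerivAt (f := fun s => -s⁻¹)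
        (fun s hs => (hasDerivAt_inv (hne s hs)).neg.congr_deriv (neg_neg _))
        hsq.intervalIntegrable]
      ring
  have : 0 < y := by linarith
  simp only [div_eq_inv_mul _ ((_ : ℝ) : ℂ), ← Complex.ofReal_inv]
  rw [hparts]
  refine (norm_sub_le_of_le (norm_sub_le _ _) hrest).trans ?_
  rw [hnorm, hnorm, inv_one, abs_one, abs_of_pos (by positivity)]
  linarith

theorem norm_dickmanExponent_add_log_le {y : ℝ} (hy : 1 ≤ y) :
    ‖dickmanExponent y + Real.log y‖ ≤ 3 := by
  have hne (s : ℝ) (hs : s ∈ Set.uIcc 1 y) : s ≠ 0 := by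
    rw [Set.uIcc_of_le hy] at hs; linarith [hs.1]
  have hinv : ContinuousOn (fun s : ℝ => (s : ℂ)⁻¹) (Set.uIcc 1 y) :=
    Complex.continuous_ofReal.continuousOn.inv₀ fun s hs => Complex.ofReal_ne_zero.2 (hne s hs)
  have hlog : ∫ s in (1 : ℝ)..y, (s : ℂ)⁻¹ = Real.log y := by
    simp only [← Complex.ofReal_inv]
    rw [intervalIntegral.integral_ofReal, integral_inv_of_pos one_pos (by linarith), div_one]
  have hslope : ∫ s in (1 : ℝ)..y, Complex.exp (Complex.I * s) / s =
      (∫ s in (1 : ℝ)..y, expSlope s) + ∫ s in (1 : ℝ)..y, (s : ℂ)⁻¹ := by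
    rw [← intervalIntegral.integral_add (continuous_expSlope.intervalIntegrable _ _)
      hinv.intervalIntegrable]
    refine intervalIntegral.integral_congr fun s hs => ?_
    simp only [expSlope_of_ne (hne s hs)]
    ring
  rw [← dickmanExponent_sub_dickmanExponent, hlog] at hslope
  have hsplit : dickmanExponent y + Real.log y =
      dickmanExponent 1 + ∫ s in (1 : ℝ)..y, Complex.exp (Complex.I * s) / s := by
    rw [hslope]; ring
  have hone : ‖dickmanExponent 1‖ ≤ 1 := by simpa using norm_dickmanExponent_le 1
  rw [hsplit]
  linarith [norm_add_le_of_le hone (norm_integral_exp_I_mul_div_le hy)]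

theorem norm_dickmanExponent_add_log_one_add_abs_le (y : ℝ) :
    ‖dickmanExponent y + Real.log (1 + |y|)‖ ≤ 4 := by
  have hlog2 : Real.log 2 ≤ 1 := by linarith [Real.log_two_lt_d9]
  wlog hy : 0 ≤ y generalizing y
  · simpa only [dickmanExponent_neg, abs_neg, ← Complex.norm_conj (dickmanExponent y + _), map_add,
      Complex.conj_ofReal] using this (-y) (by linarith)
  rw [abs_of_nonneg hy]
  rcases le_total y 1 with h1 | h1
  · have hexponent : ‖dickmanExponent y‖ ≤ 1 :=
      (norm_dickmanExponent_le y).trans (by rwa [abs_of_nonneg hy])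
    have hlog : ‖(Real.log (1 + y) : ℂ)‖ ≤ 1 := by
      rw [Complex.norm_real, Real.norm_of_nonneg (Real.log_nonneg (by linarith))]
      exact (Real.log_le_log (by linarith) (by linarith)).trans hlog2
    linarith [norm_add_le_of_le hexponent hlog]
  · have hshift : ‖((Real.log (1 + y) - Real.log y : ℝ) : ℂ)‖ ≤ 1 := by
      have hlow : Real.log y ≤ Real.log (1 + y) := Real.log_le_log (by linarith) (by linarith)
      have hhigh : Real.log (1 + y) ≤ Real.log 2 + Real.log y := by
        rw [← Real.log_mul (by norm_num) (by linarith)]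
        exact Real.log_le_log (by linarith) (by linarith)
      rw [Complex.norm_real, Real.norm_of_nonneg (by linarith)]
      linarith
    calc ‖dickmanExponent y + Real.log (1 + y)‖
        = ‖dickmanExponent y + Real.log y + ((Real.log (1 + y) - Real.log y : ℝ) : ℂ)‖ := by
          congr 1; push_cast; ring
      _ ≤ 4 := by linarith [norm_add_le_of_le (norm_dickmanExponent_add_log_le h1) hshift]

theorem continuous_dickmanChar (α : ℂ) : Continuous (dickmanChar α) := by
  have := continuous_dickmanExponent
  rw [funext (dickmanChar_eq_exp α)]
  fun_prop

theorem norm_dickmanChar_le (α : ℂ) (t : ℝ) :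
    ‖dickmanChar α t‖ ≤ Real.exp (4 * ‖α‖) * (1 + |t|) ^ (-α.re) := by
  have hsplit : α * dickmanExponent t =
      α * (dickmanExponent t + Real.log (1 + |t|)) - α * (Real.log (1 + |t|) : ℝ) := by ring
  have hbounded : (α * (dickmanExponent t + Real.log (1 + |t|))).re ≤ 4 * ‖α‖ := by
    refine (Complex.re_le_norm _).trans ?_
    rw [norm_mul, mul_comm]
    gcongr
    exact norm_dickmanExponent_add_log_one_add_abs_le t
  rw [dickmanChar_eq_exp, Complex.norm_exp, Real.rpow_def_of_pos (by positivity), ← Real.exp_add,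
    Real.exp_le_exp, hsplit, Complex.sub_re, Complex.re_mul_ofReal]
  linarith

end DickmanExponent

section PrimeSums

/-- The number `n ^ {it}` of modulus one, for `n ≠ 0`. -/
noncomputable def natTwist (t : ℝ) (n : ℕ) : ℂ := Complex.exp (Complex.I * (t * Real.log n : ℝ))

theorem norm_natTwist (t : ℝ) (n : ℕ) : ‖natTwist t n‖ = 1 := Complex.norm_exp_I_mul_ofReal _

theorem natTwist_zero_left (n : ℕ) : natTwist 0 n = 1 := by simp [natTwist]

theorem norm_natTwist_sub_one_le (t : ℝ) (n : ℕ) : ‖natTwist t n - 1‖ ≤ |t| * Real.log n := by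
  have h := Real.norm_exp_I_mul_ofReal_sub_one_le (x := t * Real.log n)
  rwa [Real.norm_eq_abs, abs_mul, abs_of_nonneg (Real.log_natCast_nonneg n)] at h

theorem exp_one_le_log_of_one_le_log_log {N : ℕ} (hN : 1 ≤ Real.log (Real.log N)) :
    Real.exp 1 ≤ Real.log N := by
  refine (Real.le_log_iff_exp_le ((Real.log_natCast_nonneg N).lt_of_ne fun h => ?_)).1 hN
  rw [← h, Real.log_zero] at hN
  linarith

theorem two_le_of_one_le_log_log {N : ℕ} (hN : 1 ≤ Real.log (Real.log N)) : 2 ≤ N := by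
  by_contra! h
  have hlog := (Real.exp_pos 1).trans_le (exp_one_le_log_of_one_le_log_log hN)
  interval_cases N <;> simp at hlog

theorem hasDerivAt_mul_expSlope_comp_mul {t u : ℝ} (ht : t ≠ 0) (hu : u ≠ 0) :
    HasDerivAt (fun u : ℝ => t * expSlope (t * u)) (t * (t * expSlopeDeriv (t * u))) u := by
  have hmul : HasDerivAt (fun u : ℝ => t * u) t u := by
    simpa using (hasDerivAt_id u).const_mul t
  exact ((hasDerivAt_expSlope (mul_ne_zero ht hu)).scomp u hmul).const_mul (t : ℂ)

theorem continuousOn_mul_expSlopeDeriv_comp_mul {t : ℝ} (ht : t ≠ 0) :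
    ContinuousOn (fun u : ℝ => (t : ℂ) * (t * expSlopeDeriv (t * u))) {0}ᶜ :=
  continuousOn_const.mul (continuousOn_const.mul (continuousOn_expSlopeDeriv.comp (by fun_prop)
    fun _ hu => mul_ne_zero ht hu))

theorem integral_norm_mul_expSlopeDeriv_comp_mul_le {t a b : ℝ} (ht : t ≠ 0) (ha : 0 < a)
    (hab : a ≤ b) :
    ∫ u in a..b, ‖(t : ℂ) * (t * expSlopeDeriv (t * u))‖ ≤
      2 * |t| * (Real.log b - Real.log a) := by
  have hpos (u : ℝ) (hu : u ∈ Set.Icc a b) : 0 < u := ha.trans_le hu.1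
  have hinv : IntervalIntegrable (fun u : ℝ => u⁻¹) volume a b :=
    (continuousOn_inv₀.mono fun u hu => (hpos u hu).ne').intervalIntegrable_of_Icc hab
  have hcont := (continuousOn_mul_expSlopeDeriv_comp_mul ht).mono fun u hu => (hpos u hu).ne'
  rw [← Real.log_div (ha.trans_le hab).ne' ha.ne', ← integral_inv_of_pos ha (ha.trans_le hab),
    ← intervalIntegral.integral_const_mul]
  refine intervalIntegral.integral_mono_on hab (hcont.norm.intervalIntegrable_of_Icc hab)
    (hinv.const_mul _) fun u hu => ?_
  rw [norm_mul, norm_mul, Complex.norm_real, Real.norm_eq_abs]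
  calc |t| * (|t| * ‖expSlopeDeriv (t * u)‖) ≤ |t| * (|t| * (2 / |t * u|)) := by
        gcongr; exact norm_expSlopeDeriv_le _
    _ = 2 * |t| * u⁻¹ := by rw [abs_mul, abs_of_pos (hpos u hu)]; field_simp

theorem exists_norm_sum_prime_Ioc_exp_sub_one_div_le :
    ∃ M : ℝ, 0 ≤ M ∧ ∀ (m n : ℕ) (t : ℝ), 2 ≤ m → m ≤ n →
      ‖∑ p ∈ Finset.Ioc m n with p.Prime, (natTwist t p - 1) / p -
          (dickmanExponent (t * Real.log n) - dickmanExponent (t * Real.log m))‖ ≤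
        M * |t| * (1 + Real.log (Real.log n) - Real.log (Real.log m)) := by
  obtain ⟨M, hM0, hM⟩ := exists_norm_sum_prime_comp_log_sub_integral_le
  refine ⟨2 * M, by positivity, fun m n t hm hmn => ?_⟩
  rcases eq_or_ne t 0 with rfl | ht
  · simp [natTwist_zero_left]
  have hlm : 0 < Real.log m := Real.log_pos (by exact_mod_cast hm)
  have hlmn : Real.log m ≤ Real.log n :=
    Real.log_le_log (by exact_mod_cast (by omega : 0 < m)) (by exact_mod_cast hmn)
  have hne (u : ℝ) (hu : u ∈ Set.Icc (Real.log m) (Real.log n)) : u ≠ 0 :=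
    (hlm.trans_le hu.1).ne'
  have hbound (u : ℝ) : ‖(t : ℂ) * expSlope (t * u)‖ ≤ |t| := by
    rw [norm_mul, Complex.norm_real, Real.norm_eq_abs]
    exact mul_le_of_le_one_right (abs_nonneg t) (norm_expSlope_le _)
  have key := hM m n _ _ (by omega) hmn
    (fun u hu => hasDerivAt_mul_expSlope_comp_mul ht (hne u hu))
    ((continuousOn_mul_expSlopeDeriv_comp_mul ht).mono hne)
  rw [integral_mul_expSlope_comp_mul] at key
  have hsum : ∑ p ∈ Finset.Ioc m n with p.Prime,
        (natTwist t p - 1) / p =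
      ∑ p ∈ Finset.Ioc m n with p.Prime, t * expSlope (t * Real.log p) * (Real.log p / p) := by
    refine Finset.sum_congr rfl fun p _ => ?_
    rw [natTwist, ← mul_expSlope, Complex.ofReal_mul]
    ring
  rw [hsum]
  calc _ ≤ _ := key
    _ ≤ M * (|t| + |t| + 2 * |t| * (Real.log (Real.log n) - Real.log (Real.log m))) := by
        gcongr
        exacts [hbound _, hbound _, integral_norm_mul_expSlopeDeriv_comp_mul_le ht hlm hlmn]
    _ = _ := by ring

theorem exists_norm_sum_primesLE_exp_sub_one_div_sub_dickmanExponent_le :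
    ∃ K : ℝ, 0 ≤ K ∧ ∀ (N : ℕ) (t : ℝ), 1 ≤ Real.log (Real.log N) →
      ‖∑ p ∈ N.primesLE, (natTwist t p - 1) / p - dickmanExponent (t * Real.log N)‖ ≤
        K * |t| * Real.log (Real.log N) := by
  obtain ⟨M, hM0, hM⟩ := exists_norm_sum_prime_Ioc_exp_sub_one_div_le
  refine ⟨3 * M + 2, by positivity, fun N t hN => ?_⟩
  have hN2 : 2 ≤ N := two_le_of_one_le_log_log hN
  have hlog2 : 0 < Real.log 2 ∧ Real.log 2 ≤ 1 :=
    ⟨Real.log_pos one_lt_two, by linarith [Real.log_two_lt_d9]⟩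
  have hloglog2 : -1 ≤ Real.log (Real.log 2) := by
    rw [Real.le_log_iff_exp_le hlog2.1, Real.exp_neg]
    refine inv_le_of_inv_le₀ hlog2.1 ?_
    rw [inv_le_iff_one_le_mul₀ hlog2.1]
    nlinarith [Real.exp_one_gt_d9, Real.log_two_gt_d9]
  have hlinear : |t| * Real.log 2 ≤ |t| := mul_le_of_le_one_right (abs_nonneg t) hlog2.2
  have htwo : ‖(natTwist t 2 - 1) / 2‖ ≤ |t| := by
    rw [norm_div, Complex.norm_two]
    have htwist := norm_natTwist_sub_one_le t 2
    rw [Nat.cast_ofNat] at htwist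
    linarith [abs_nonneg t]
  have hE2 : ‖dickmanExponent (t * Real.log 2)‖ ≤ |t| :=
    (norm_dickmanExponent_le _).trans (by rwa [abs_mul, abs_of_pos hlog2.1])
  have hmain := hM 2 N t le_rfl hN2
  have hsplit := sum_primesLE_sub_sum_primesLE
    (fun p => (natTwist t p - 1) / (p : ℂ)) hN2
  rw [show Nat.primesLE 2 = {2} by decide, Finset.sum_singleton, Nat.cast_ofNat] at hsplit
  rw [← hsplit, Nat.cast_ofNat] at hmain
  calc _ = ‖(∑ p ∈ N.primesLE, (natTwist t p - 1) / (p : ℂ) - (natTwist t 2 - 1) / 2 -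
          (dickmanExponent (t * Real.log N) - dickmanExponent (t * Real.log 2))) +
        ((natTwist t 2 - 1) / 2 - dickmanExponent (t * Real.log 2))‖ := by congr 1; ring
    _ ≤ M * |t| * (1 + Real.log (Real.log N) - Real.log (Real.log 2)) + (|t| + |t|) :=
        norm_add_le_of_le hmain (norm_sub_le_of_le htwo hE2)
    _ ≤ M * |t| * (3 * Real.log (Real.log N)) + 2 * |t| * Real.log (Real.log N) := by
        gcongr
        · linarith
        · linarith [le_mul_of_one_le_right (abs_nonneg t) hN]
    _ = _ := by ring

end PrimeSums

section EulerProduct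

/-- The function `h` with `1 + z + ⋯ + z ^ (k - 1) = exp (z + h z)` on the unit disc. -/
noncomputable def geomLogRemainder (k : ℕ) (z : ℂ) : ℂ :=
  Complex.log (1 - z ^ k) - Complex.log (1 - z) - z

theorem one_sub_mem_slitPlane {z : ℂ} (hz : ‖z‖ < 1) : 1 - z ∈ Complex.slitPlane := by
  rw [sub_eq_add_neg]
  exact Complex.mem_slitPlane_of_norm_lt_one (by rwa [norm_neg])

theorem exp_add_geomLogRemainder {k : ℕ} (hk : k ≠ 0) {z : ℂ} (hz : ‖z‖ < 1) :
    Complex.exp (z + geomLogRemainder k z) = ∑ j ∈ Finset.range k, z ^ j := by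
  have hzk : ‖z ^ k‖ < 1 := by rw [norm_pow]; exact pow_lt_one₀ (norm_nonneg z) hz hk
  have h1 := Complex.slitPlane_ne_zero (one_sub_mem_slitPlane hz)
  have h2 := Complex.slitPlane_ne_zero (one_sub_mem_slitPlane hzk)
  rw [geomLogRemainder, add_sub_cancel, Complex.exp_sub, Complex.exp_log h1, Complex.exp_log h2,
    div_eq_iff h1, geom_sum_mul_neg]

theorem geomLogRemainder_zero {k : ℕ} (hk : k ≠ 0) : geomLogRemainder k 0 = 0 := by
  simp [geomLogRemainder, hk]

theorem hasDerivAt_geomLogRemainder {k : ℕ} (hk : k ≠ 0) {z : ℂ} (hz : ‖z‖ < 1) :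
    HasDerivAt (geomLogRemainder k) (z / (1 - z) - k * z ^ (k - 1) / (1 - z ^ k)) z := by
  have hzk : ‖z ^ k‖ < 1 := by rw [norm_pow]; exact pow_lt_one₀ (norm_nonneg z) hz hk
  have h1 : HasDerivAt (fun z : ℂ => 1 - z) (-1) z := by
    simpa using (hasDerivAt_id z).const_sub 1
  have h2 : HasDerivAt (fun z : ℂ => 1 - z ^ k) (-(k * z ^ (k - 1))) z :=
    (hasDerivAt_pow k z).const_sub 1
  refine (((h2.clog (one_sub_mem_slitPlane hzk)).sub
    (h1.clog (one_sub_mem_slitPlane hz))).sub (hasDerivAt_id z)).congr_deriv ?_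
  have h3 := Complex.slitPlane_ne_zero (one_sub_mem_slitPlane hz)
  field_simp
  ring

theorem norm_geomLogRemainder_sub_le {k : ℕ} (hk : 2 ≤ k) {ρ r : ℝ} (hρ : ρ < 1) (hr : r ≤ ρ)
    {z w : ℂ} (hz : ‖z‖ ≤ r) (hw : ‖w‖ ≤ r) :
    ‖geomLogRemainder k z - geomLogRemainder k w‖ ≤ (k + 1) * r / (1 - ρ) * ‖z - w‖ := by
  have hk0 : k ≠ 0 := by omega
  have hr0 : 0 ≤ r := (norm_nonneg z).trans hz
  refine (convex_closedBall (0 : ℂ) r).norm_image_sub_le_of_norm_hasDerivWithin_le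
    (fun x hx => (hasDerivAt_geomLogRemainder hk0 ?_).hasDerivWithinAt) (fun x hx => ?_)
    (mem_closedBall_zero_iff.2 hw) (mem_closedBall_zero_iff.2 hz)
  · linarith [mem_closedBall_zero_iff.1 hx]
  have hxr : ‖x‖ ≤ r := mem_closedBall_zero_iff.1 hx
  have : 0 < 1 - ρ := by linarith
  have hpow (j : ℕ) (hj : j ≠ 0) : ‖x ^ j‖ ≤ r := by
    rw [norm_pow]
    exact (pow_le_of_le_one (norm_nonneg x) (by linarith) hj).trans hxr
  have hdenom {y : ℂ} (hy : ‖y‖ ≤ r) : 1 - ρ ≤ ‖1 - y‖ := by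
    have := norm_sub_norm_le (1 : ℂ) y
    rw [norm_one] at this
    linarith
  calc ‖x / (1 - x) - k * x ^ (k - 1) / (1 - x ^ k)‖
      ≤ ‖x‖ / ‖1 - x‖ + k * ‖x ^ (k - 1)‖ / ‖1 - x ^ k‖ := by
        refine (norm_sub_le _ _).trans_eq ?_
        rw [norm_div, norm_div, norm_mul, Complex.norm_natCast]
    _ ≤ r / (1 - ρ) + k * r / (1 - ρ) := by
        gcongr
        exacts [hdenom hxr, hpow _ (by omega), hdenom (hpow _ hk0)]
    _ = _ := by ring

theorem div_prime_le_div_two {a : ℝ} (ha : 0 ≤ a) {p : ℕ} (hp : p.Prime) : a / p ≤ a / 2 := by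
  gcongr
  exact_mod_cast hp.two_le

theorem exists_norm_geomLogRemainder_sub_le_div_prime {k : ℕ} (hk : 2 ≤ k) {a : ℝ} (ha0 : 0 ≤ a)
    (ha : a < 2) :
    ∃ K : ℝ, 0 ≤ K ∧ ∀ p : ℕ, p.Prime → ∀ z w : ℂ, ‖z‖ ≤ a / p → ‖w‖ ≤ a / p →
      ‖geomLogRemainder k z - geomLogRemainder k w‖ ≤ K / p * ‖z - w‖ := by
  have hρ : 0 < 1 - a / 2 := by linarith
  refine ⟨(k + 1) * a / (1 - a / 2), by positivity, fun p hp z w hz hw => ?_⟩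
  refine (norm_geomLogRemainder_sub_le hk (by linarith) (div_prime_le_div_two ha0 hp) hz
    hw).trans_eq ?_
  ring

theorem exists_norm_sum_range_sub_tsum_le_div_log {g : ℕ → ℂ} {c : ℝ}
    (hg : ∀ n, ‖g n‖ ≤ c / (n : ℝ) ^ 2) :
    ∃ K : ℝ, ∀ N : ℕ, 2 ≤ N →
      ‖∑ n ∈ Finset.range (N + 1), g n - ∑' n, g n‖ ≤ K / Real.log N := by
  have hc : 0 ≤ c := by simpa using (norm_nonneg _).trans (hg 1)
  have hsummable : Summable g := Summable.of_norm_bounded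
    ((Real.summable_one_div_nat_pow.2 one_lt_two).mul_left c) fun n => by
      simpa only [mul_one_div] using hg n
  set T := ∑' n : ℕ, Real.log n / (n : ℝ) ^ 2 with hT
  refine ⟨c * T, fun N hN => ?_⟩
  have hlog : 0 < Real.log N := Real.log_pos (by exact_mod_cast hN)
  have htail := (summable_nat_add_iff (N + 1)).2 summable_log_div_sq
  rw [← hsummable.sum_add_tsum_nat_add (N + 1), sub_add_cancel_left, norm_neg]
  have hterm (i : ℕ) : ‖g (i + (N + 1))‖ ≤
      c / Real.log N * (Real.log (i + (N + 1) : ℕ) / ((i + (N + 1) : ℕ) : ℝ) ^ 2) := by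
    have hmono : Real.log N ≤ Real.log (i + (N + 1) : ℕ) :=
      Real.log_le_log (by exact_mod_cast (by omega : 0 < N)) (by exact_mod_cast (by omega))
    calc ‖g (i + (N + 1))‖ ≤ _ := hg _
      _ = c / Real.log N * (Real.log N / ((i + (N + 1) : ℕ) : ℝ) ^ 2) := by field_simp
      _ ≤ _ := by gcongr
  have htail_le : ∑' i : ℕ, Real.log (i + (N + 1) : ℕ) / ((i + (N + 1) : ℕ) : ℝ) ^ 2 ≤ T := by
    rw [hT, ← summable_log_div_sq.sum_add_tsum_nat_add (N + 1)]
    exact le_add_of_nonneg_left (Finset.sum_nonneg fun n _ => by positivity)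
  calc _ ≤ _ := tsum_of_norm_bounded (htail.hasSum.mul_left (c / Real.log N)) hterm
    _ ≤ c / Real.log N * T := by gcongr
    _ = c * T / Real.log N := by ring

/-- The contribution of the integer `n`, which vanishes unless `n` is prime, to the convergent
series in the exponent of `smoothConst`. -/
noncomputable def primeGeomLogRemainder (k : ℕ) (α : ℂ) (n : ℕ) : ℂ :=
  if n.Prime then geomLogRemainder k (α / n) else 0

variable {k : ℕ} {α : ℂ}

theorem exists_norm_sum_geomLogRemainder_sub_tsum_le (hk : 2 ≤ k) (hα : ‖α‖ < 2) :
    ∃ K : ℝ, ∀ N : ℕ, 2 ≤ N →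
      ‖∑ p ∈ N.primesLE, geomLogRemainder k (α / p) - ∑' n, primeGeomLogRemainder k α n‖ ≤
        K / Real.log N := by
  obtain ⟨K, hK0, hK⟩ := exists_norm_geomLogRemainder_sub_le_div_prime hk (norm_nonneg α) hα
  have hg (n : ℕ) : ‖primeGeomLogRemainder k α n‖ ≤ K * ‖α‖ / (n : ℝ) ^ 2 := by
    rw [primeGeomLogRemainder]
    split_ifs with hn
    · have h := hK n hn (α / n) 0 (by rw [norm_div, Complex.norm_natCast])
        (by rw [norm_zero]; positivity)
      rw [geomLogRemainder_zero (by omega), sub_zero, sub_zero, norm_div,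
        Complex.norm_natCast] at h
      exact h.trans_eq (by ring)
    · rw [norm_zero]; positivity
  obtain ⟨K', hK'⟩ := exists_norm_sum_range_sub_tsum_le_div_log hg
  refine ⟨K', fun N hN => ?_⟩
  rw [Nat.primesLE_eq_filter_range, Finset.sum_filter]
  exact hK' N hN

theorem exists_norm_sum_geomLogRemainder_natTwist_sub_le (hk : 2 ≤ k) (hα : ‖α‖ < 2) :
    ∃ K : ℝ, 0 ≤ K ∧ ∀ (N : ℕ) (t : ℝ),
      ‖∑ p ∈ N.primesLE, (geomLogRemainder k (α / p * natTwist t p) -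
        geomLogRemainder k (α / p))‖ ≤ K * |t| := by
  obtain ⟨K, hK0, hK⟩ := exists_norm_geomLogRemainder_sub_le_div_prime hk (norm_nonneg α) hα
  set T := ∑' n : ℕ, Real.log n / (n : ℝ) ^ 2
  have : 0 ≤ T := tsum_nonneg fun n => by positivity
  refine ⟨K * ‖α‖ * T, by positivity, fun N t => ?_⟩
  have hterm (p : ℕ) (hp : p ∈ N.primesLE) :
      ‖geomLogRemainder k (α / p * natTwist t p) - geomLogRemainder k (α / p)‖ ≤
        K * ‖α‖ * |t| * (Real.log p / (p : ℝ) ^ 2) := by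
    have hnorm : ‖α / p‖ = ‖α‖ / p := by rw [norm_div, Complex.norm_natCast]
    calc _ ≤ K / p * ‖α / p * natTwist t p - α / p‖ :=
          hK p (Nat.prime_of_mem_primesLE hp) _ _
            (by rw [norm_mul, norm_natTwist, mul_one, hnorm]) hnorm.le
      _ = K / p * (‖α‖ / p * ‖natTwist t p - 1‖) := by rw [← mul_sub_one, norm_mul, hnorm]
      _ ≤ K / p * (‖α‖ / p * (|t| * Real.log p)) := by
          gcongr; exact norm_natTwist_sub_one_le t p
      _ = _ := by ring
  refine (norm_sum_le_of_le _ hterm).trans ?_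
  rw [← Finset.mul_sum]
  calc _ ≤ K * ‖α‖ * |t| * T := by
        gcongr; exact summable_log_div_sq.sum_le_tsum _ fun i _ => by positivity
    _ = _ := by ring

/-- The product `∏ p ≤ N, (1 + z_p + ⋯ + z_p ^ (k - 1))` with `z_p = α p ^ {it} / p`. -/
noncomputable def smoothEulerProduct (k : ℕ) (α : ℂ) (N : ℕ) (t : ℝ) : ℂ :=
  ∏ p ∈ N.primesLE, ∑ j ∈ Finset.range k, (α / p * natTwist t p) ^ j

/-- The constant `C(k, α)` of the asymptotic formula for `smoothEulerProduct`. -/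
noncomputable def smoothConst (k : ℕ) (α : ℂ) : ℂ :=
  Complex.exp (α * meisselMertens + ∑' n, primeGeomLogRemainder k α n)

theorem smoothConst_ne_zero (k : ℕ) (α : ℂ) : smoothConst k α ≠ 0 := Complex.exp_ne_zero _

theorem smoothEulerProduct_eq_exp (hk : k ≠ 0) (hα : ‖α‖ < 2) (N : ℕ) (t : ℝ) :
    smoothEulerProduct k α N t = Complex.exp
      (α * (∑ p ∈ N.primesLE, 1 / (p : ℝ) : ℝ) + α * ∑ p ∈ N.primesLE, (natTwist t p - 1) / p +
        ∑ p ∈ N.primesLE, geomLogRemainder k (α / p * natTwist t p)) := by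
  have hprod : smoothEulerProduct k α N t = Complex.exp (∑ p ∈ N.primesLE,
      (α / p * natTwist t p + geomLogRemainder k (α / p * natTwist t p))) := by
    rw [smoothEulerProduct, Complex.exp_sum]
    refine Finset.prod_congr rfl fun p hp => (exp_add_geomLogRemainder hk ?_).symm
    rw [norm_mul, norm_natTwist, mul_one, norm_div, Complex.norm_natCast]
    linarith [div_prime_le_div_two (norm_nonneg α) (Nat.prime_of_mem_primesLE hp)]
  rw [hprod, Complex.ofReal_sum, Finset.mul_sum, Finset.mul_sum, ← Finset.sum_add_distrib,
    ← Finset.sum_add_distrib]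
  refine congrArg Complex.exp (Finset.sum_congr rfl fun p _ => ?_)
  push_cast
  ring

theorem exists_smoothEulerProduct_eq_mul_exp (hk : 2 ≤ k) (hα : ‖α‖ < 2) :
    ∃ K : ℝ, 0 ≤ K ∧ ∀ (N : ℕ) (t : ℝ), 1 ≤ Real.log (Real.log N) →
      ∃ δ : ℂ, ‖δ‖ ≤ K * (1 / Real.log N + |t| * Real.log (Real.log N)) ∧
        smoothEulerProduct k α N t =
          smoothConst k α * (Real.log N : ℂ) ^ α * dickmanChar α (t * Real.log N) *
            Complex.exp δ := by
  obtain ⟨K₁, h₁⟩ := exists_abs_primeReciprocalDefect_sub_meisselMertens_le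
  obtain ⟨K₂, _, h₂⟩ := exists_norm_sum_primesLE_exp_sub_one_div_sub_dickmanExponent_le
  obtain ⟨K₃, h₃⟩ := exists_norm_sum_geomLogRemainder_sub_tsum_le hk hα
  obtain ⟨K₄, hK₄, h₄⟩ := exists_norm_sum_geomLogRemainder_natTwist_sub_le hk hα
  set A := ‖α‖ * K₁ + K₃
  set B := ‖α‖ * K₂ + K₄
  refine ⟨max 0 (max A B), le_max_left _ _, fun N t hN => ?_⟩
  set δ₁ : ℝ := primeReciprocalDefect N - meisselMertens with hδ₁
  set δ₂ : ℂ := ∑ p ∈ N.primesLE, (natTwist t p - 1) / p - dickmanExponent (t * Real.log N)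
    with hδ₂
  set δ₃ : ℂ := ∑ p ∈ N.primesLE, geomLogRemainder k (α / p) - ∑' n, primeGeomLogRemainder k α n
    with hδ₃
  set δ₄ : ℂ := ∑ p ∈ N.primesLE,
    (geomLogRemainder k (α / p * natTwist t p) - geomLogRemainder k (α / p)) with hδ₄
  have hN2 := two_le_of_one_le_log_log hN
  have hlog : 0 < Real.log N := Real.log_pos (by exact_mod_cast hN2)
  refine ⟨α * δ₁ + α * δ₂ + δ₃ + δ₄, ?_, ?_⟩
  · have e₁ : ‖α * δ₁‖ ≤ ‖α‖ * (K₁ / Real.log N) := by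
      rw [norm_mul, Complex.norm_real]; gcongr; exact h₁ N hN2
    have e₂ : ‖α * δ₂‖ ≤ ‖α‖ * (K₂ * |t| * Real.log (Real.log N)) := by
      rw [norm_mul]; gcongr; exact h₂ N t hN
    have e₄ : ‖δ₄‖ ≤ K₄ * |t| * Real.log (Real.log N) :=
      (h₄ N t).trans (le_mul_of_one_le_right (by positivity) hN)
    calc _ ≤ _ := norm_add_le_of_le (norm_add_le_of_le (norm_add_le_of_le e₁ e₂) (h₃ N hN2)) e₄
      _ = A * (1 / Real.log N) + B * (|t| * Real.log (Real.log N)) := by simp only [A, B]; ring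
      _ ≤ max 0 (max A B) * (1 / Real.log N) +
          max 0 (max A B) * (|t| * Real.log (Real.log N)) := by gcongr <;> simp
      _ = _ := by ring
  · have hlogc : (Real.log N : ℂ) ≠ 0 := Complex.ofReal_ne_zero.2 hlog.ne'
    rw [smoothEulerProduct_eq_exp (by omega) hα, smoothConst, dickmanChar_eq_exp,
      Complex.cpow_def_of_ne_zero hlogc, ← Complex.ofReal_log hlog.le, ← Complex.exp_add,
      ← Complex.exp_add, ← Complex.exp_add]
    congr 1
    simp only [hδ₁, hδ₂, hδ₃, hδ₄, primeReciprocalDefect, Finset.sum_sub_distrib]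
    push_cast
    ring

theorem norm_smoothEulerProduct_le (k : ℕ) (α : ℂ) (N : ℕ) (t : ℝ) :
    ‖smoothEulerProduct k α N t‖ ≤ ‖smoothEulerProduct k (‖α‖ : ℝ) N 0‖ := by
  rw [smoothEulerProduct, smoothEulerProduct, norm_prod, norm_prod]
  refine Finset.prod_le_prod (fun _ _ => norm_nonneg _) fun p _ => ?_
  have hreal : ∑ j ∈ Finset.range k, (((‖α‖ : ℝ) : ℂ) / p * natTwist 0 p) ^ j =
      ((∑ j ∈ Finset.range k, (‖α‖ / p) ^ j : ℝ) : ℂ) := by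
    simp [natTwist_zero_left]
  rw [hreal, Complex.norm_real, Real.norm_of_nonneg (by positivity)]
  refine norm_sum_le_of_le _ fun j _ => ?_
  rw [norm_pow, norm_mul, norm_natTwist, mul_one, norm_div, Complex.norm_natCast]

theorem continuous_smoothEulerProduct (k : ℕ) (α : ℂ) (N : ℕ) :
    Continuous (smoothEulerProduct k α N) := by
  unfold smoothEulerProduct natTwist
  fun_prop

theorem norm_smoothConst_mul_log_cpow {N : ℕ} (hN : 0 < Real.log N) :
    ‖smoothConst k α * (Real.log N : ℂ) ^ α‖ = ‖smoothConst k α‖ * Real.log N ^ α.re := by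
  rw [norm_mul, Complex.norm_cpow_eq_rpow_re_of_pos hN]

theorem smoothConst_mul_log_cpow_ne_zero {N : ℕ} (hN : 0 < Real.log N) :
    smoothConst k α * (Real.log N : ℂ) ^ α ≠ 0 := by
  have hconst := norm_pos_iff.2 (smoothConst_ne_zero k α)
  rw [← norm_pos_iff, norm_smoothConst_mul_log_cpow hN]
  positivity

theorem exists_norm_smoothEulerProduct_div_le (hk : 2 ≤ k) (hα : ‖α‖ < 2) :
    ∃ K : ℝ, 0 ≤ K ∧ ∀ N : ℕ, 1 ≤ Real.log (Real.log N) →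
      ‖smoothEulerProduct k (‖α‖ : ℝ) N 0‖ / ‖smoothConst k α * (Real.log N : ℂ) ^ α‖ ≤
        K * Real.log N ^ (‖α‖ - α.re) := by
  have hα' : ‖((‖α‖ : ℝ) : ℂ)‖ < 2 := by simpa using hα
  obtain ⟨K, hK, h⟩ := exists_smoothEulerProduct_eq_mul_exp hk hα'
  refine ⟨‖smoothConst k (‖α‖ : ℝ)‖ * Real.exp K / ‖smoothConst k α‖, by positivity,
    fun N hN => ?_⟩
  obtain ⟨δ, hδK, hδ⟩ := h N 0 hN
  have hlog1 : 1 ≤ Real.log N := by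
    linarith [exp_one_le_log_of_one_le_log_log hN, Real.add_one_le_exp 1]
  have hlog0 : 0 < Real.log N := by linarith
  have hexp : ‖Complex.exp δ‖ ≤ Real.exp K := by
    rw [Complex.norm_exp]
    refine Real.exp_le_exp.2 ((Complex.re_le_norm _).trans (hδK.trans ?_))
    rw [abs_zero, zero_mul, add_zero]
    exact mul_le_of_le_one_right hK (div_le_one_of_le₀ hlog1 hlog0.le)
  have hchar : dickmanChar (‖α‖ : ℝ) (0 * Real.log N) = 1 := by
    rw [dickmanChar_eq_exp, dickmanExponent_eq_integral]; simp
  rw [hδ, hchar, mul_one, norm_mul, norm_smoothConst_mul_log_cpow hlog0,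
    norm_smoothConst_mul_log_cpow hlog0, Complex.ofReal_re, Real.rpow_sub hlog0]
  calc _ ≤ ‖smoothConst k (‖α‖ : ℝ)‖ * Real.log N ^ ‖α‖ * Real.exp K /
          (‖smoothConst k α‖ * Real.log N ^ α.re) := by gcongr
    _ = _ := by ring

theorem one_le_cutoff {N : ℕ} (hN : 1 ≤ Real.log (Real.log N)) : 1 ≤ cutoff N := by
  rw [cutoff, one_le_div₀ (by linarith)]
  exact Real.log_le_self (Real.log_natCast_nonneg N)

/-- The function of `t` equal to `smoothEulerProduct` at `t / log N` divided by the order of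
magnitude `C (log N) ^ α` of `smoothSum`. It converges to `dickmanChar α`. -/
noncomputable def normalizedEulerProduct (k : ℕ) (α : ℂ) (N : ℕ) (t : ℝ) : ℂ :=
  smoothEulerProduct k α N (t / Real.log N) / (smoothConst k α * (Real.log N : ℂ) ^ α)

theorem continuous_normalizedEulerProduct (k : ℕ) (α : ℂ) (N : ℕ) :
    Continuous (normalizedEulerProduct k α N) :=
  ((continuous_smoothEulerProduct k α N).comp (continuous_id.div_const _)).div_const _

theorem norm_normalizedEulerProduct_le (k : ℕ) (α : ℂ) (N : ℕ) (t : ℝ) :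
    ‖normalizedEulerProduct k α N t‖ ≤
      ‖smoothEulerProduct k (‖α‖ : ℝ) N 0‖ / ‖smoothConst k α * (Real.log N : ℂ) ^ α‖ := by
  rw [normalizedEulerProduct, norm_div]
  gcongr
  exact norm_smoothEulerProduct_le k α N _

theorem exists_norm_normalizedEulerProduct_le (hk : 2 ≤ k) (hα : ‖α‖ < 2) :
    ∃ K : ℝ, 0 ≤ K ∧ ∀ (N : ℕ) (t : ℝ), 1 ≤ Real.log (Real.log N) →
      ‖normalizedEulerProduct k α N t‖ ≤ K * Real.log N ^ (‖α‖ - α.re) := by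
  obtain ⟨K, hK, h⟩ := exists_norm_smoothEulerProduct_div_le hk hα
  exact ⟨K, hK, fun N t hN => (norm_normalizedEulerProduct_le k α N t).trans (h N hN)⟩

theorem norm_exp_sub_one_le_mul_exp (z : ℂ) : ‖Complex.exp z - 1‖ ≤ ‖z‖ * Real.exp ‖z‖ := by
  simpa using Complex.norm_exp_sub_sum_le_norm_mul_exp z 1

theorem exists_norm_normalizedEulerProduct_sub_dickmanChar_le (hk : 2 ≤ k) (hα : ‖α‖ < 2) :
    ∃ K : ℝ, 0 ≤ K ∧ ∀ (N : ℕ) (t : ℝ), 1 ≤ Real.log (Real.log N) → |t| ≤ cutoff N →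
      ‖normalizedEulerProduct k α N t - dickmanChar α t‖ ≤
        K * (1 + |t|) ^ (1 - α.re) / cutoff N := by
  obtain ⟨K, hK, h⟩ := exists_smoothEulerProduct_eq_mul_exp hk hα
  refine ⟨Real.exp (4 * ‖α‖) * (K * Real.exp (2 * K)), by positivity, fun N t hN ht => ?_⟩
  have hR := one_le_cutoff hN
  have hlog : 0 < Real.log N := (Real.exp_pos 1).trans_le (exp_one_le_log_of_one_le_log_log hN)
  obtain ⟨δ, hδK, hδ⟩ := h N (t / Real.log N) hN
  rw [div_mul_cancel₀ t hlog.ne'] at hδ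
  have hδ_le : ‖δ‖ ≤ K * ((1 + |t|) / cutoff N) := by
    refine hδK.trans ?_
    rw [abs_div, abs_of_pos hlog]
    calc K * (1 / Real.log N + |t| / Real.log N * Real.log (Real.log N))
        ≤ K * (Real.log (Real.log N) / Real.log N +
            |t| / Real.log N * Real.log (Real.log N)) := by gcongr
      _ = _ := by rw [cutoff]; field_simp
  have hδ_le' : ‖δ‖ ≤ 2 * K := by
    have hquot : (1 + |t|) / cutoff N ≤ 2 := by rw [div_le_iff₀ (by linarith)]; linarith
    linarith [mul_le_mul_of_nonneg_left hquot hK]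
  have hsub : normalizedEulerProduct k α N t - dickmanChar α t =
      dickmanChar α t * (Complex.exp δ - 1) := by
    rw [normalizedEulerProduct, hδ, mul_assoc,
      mul_div_cancel_left₀ _ (smoothConst_mul_log_cpow_ne_zero hlog), mul_sub_one]
  rw [hsub, norm_mul]
  calc _ ≤ Real.exp (4 * ‖α‖) * (1 + |t|) ^ (-α.re) * (‖δ‖ * Real.exp ‖δ‖) := by
        gcongr
        exacts [norm_dickmanChar_le α t, norm_exp_sub_one_le_mul_exp δ]
    _ ≤ Real.exp (4 * ‖α‖) * (1 + |t|) ^ (-α.re) *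
          (K * ((1 + |t|) / cutoff N) * Real.exp (2 * K)) := by gcongr
    _ = _ := by
        rw [sub_eq_neg_add, Real.rpow_add_one (by positivity)]
        ring

end EulerProduct

section KFree

/-- The natural number `n` is `k`-free: no prime `p` satisfies `p ^ k ∣ n`. -/
def KFree (k n : ℕ) : Prop := ∀ p : ℕ, p.Prime → ¬p ^ k ∣ n

variable {k : ℕ}

theorem KFree.ne_zero {n : ℕ} (hn : KFree k n) : n ≠ 0 := fun h =>
  hn 2 Nat.prime_two (h ▸ dvd_zero _)

theorem kFree_mul_iff (hk : k ≠ 0) {m n : ℕ} (hmn : m.Coprime n) :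
    KFree k (m * n) ↔ KFree k m ∧ KFree k n := by
  rw [KFree, KFree, KFree, ← forall₂_and]
  refine forall₂_congr fun p hp => ?_
  rw [hmn.isPrimePow_dvd_mul (hp.isPrimePow.pow hk), not_or]

theorem kFree_prime_pow_iff (hk : k ≠ 0) {p : ℕ} (hp : p.Prime) {j : ℕ} :
    KFree k (p ^ j) ↔ j < k := by
  refine ⟨fun h => not_le.1 fun hkj => h p hp (pow_dvd_pow p hkj), fun hjk q hq hdvd => ?_⟩
  obtain rfl : q = p := (Nat.prime_dvd_prime_iff_eq hq hp).1
    (hq.dvd_of_dvd_pow ((dvd_pow_self q hk).trans hdvd))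
  exact hjk.not_ge ((Nat.pow_dvd_pow_iff_le_right hq.one_lt).1 hdvd)

theorem smoothKFree_eq_inter (k N : ℕ) :
    smoothKFree k N = (N + 1).smoothNumbers ∩ {n | KFree k n} := by
  ext n
  simp only [Set.mem_inter_iff, Set.mem_ofPred_eq, Nat.mem_smoothNumbers', Nat.lt_succ_iff]
  exact ⟨fun h => ⟨h.2.2, h.2.1⟩, fun h => ⟨h.2.ne_zero, h.2, h.1⟩⟩

theorem indicator_kFree_one (hk : k ≠ 0) (F : ℕ → ℂ) : {n | KFree k n}.indicator F 1 = F 1 :=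
  Set.indicator_of_mem (fun p hp h => hp.one_lt.ne'
    (Nat.dvd_one.1 ((dvd_pow_self p hk).trans h))) F

theorem indicator_kFree_mul (hk : k ≠ 0) {F : ℕ → ℂ}
    (hmul : ∀ m n, m ≠ 0 → n ≠ 0 → F (m * n) = F m * F n) {m n : ℕ} (hmn : m.Coprime n) :
    {n | KFree k n}.indicator F (m * n) =
      {n | KFree k n}.indicator F m * {n | KFree k n}.indicator F n := by
  classical
  simp only [Set.indicator_apply, Set.mem_ofPred_eq, kFree_mul_iff hk hmn]
  split_ifs with h₁ h₂ h₃ <;> first | simp_all; done | exact hmul m n h₂.ne_zero h₃.ne_zero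

theorem indicator_kFree_prime_pow (hk : k ≠ 0) {F : ℕ → ℂ} (hone : F 1 = 1)
    (hmul : ∀ m n, m ≠ 0 → n ≠ 0 → F (m * n) = F m * F n) {p : ℕ} (hp : p.Prime) (j : ℕ) :
    {n | KFree k n}.indicator F (p ^ j) = if j < k then F p ^ j else 0 := by
  classical
  have hpow : F (p ^ j) = F p ^ j := by
    induction j with
    | zero => rw [pow_zero, pow_zero, hone]
    | succ j ih => rw [pow_succ, hmul _ _ (pow_ne_zero _ hp.ne_zero) hp.ne_zero, ih, pow_succ]
  simp only [Set.indicator_apply, Set.mem_ofPred_eq, kFree_prime_pow_iff hk hp, hpow]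

theorem sum_smoothKFree_eq_prod (hk : k ≠ 0) (N : ℕ) {F : ℕ → ℂ} (hone : F 1 = 1)
    (hmul : ∀ m n, m ≠ 0 → n ≠ 0 → F (m * n) = F m * F n) :
    ∑ n ∈ (smoothKFree_finite k N).toFinset, F n =
      ∏ p ∈ N.primesLE, ∑ j ∈ Finset.range k, F p ^ j := by
  set G : ℕ → ℂ := {n | KFree k n}.indicator F with hG
  have hvanish {p : ℕ} (hp : p.Prime) (j : ℕ) (hj : j ∉ Finset.range k) : G (p ^ j) = 0 := by
    rw [hG, indicator_kFree_prime_pow hk hone hmul hp, if_neg (by simpa using hj)]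
  have hfactor (p : ℕ) (hp : p ∈ N.primesLE) :
      ∑' j, G (p ^ j) = ∑ j ∈ Finset.range k, F p ^ j := by
    have hp' := Nat.prime_of_mem_primesLE hp
    rw [tsum_eq_sum (hvanish hp')]
    refine Finset.sum_congr rfl fun j hj => ?_
    rw [hG, indicator_kFree_prime_pow hk hone hmul hp', if_pos (Finset.mem_range.1 hj)]
  have hsum : HasSum (fun n : (N + 1).smoothNumbers => G n)
      (∏ p ∈ N.primesLE, ∑' j, G (p ^ j)) :=
    (EulerProduct.summable_and_hasSum_smoothNumbers_prod_primesBelow_tsum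
      ((indicator_kFree_one hk F).trans hone) (indicator_kFree_mul hk hmul)
      (fun hp => summable_of_ne_finset_zero (s := Finset.range k)
        fun j hj => norm_eq_zero.2 (hvanish hp j hj)) (N + 1)).2
  have hsum' := (hasSum_subtype_iff_indicator (f := G)).1 hsum
  rw [hG, Set.indicator_indicator, ← smoothKFree_eq_inter] at hsum'
  rw [← Finset.prod_congr rfl hfactor, ← hsum'.tsum_eq,
    tsum_eq_sum (s := (smoothKFree_finite k N).toFinset) fun n hn =>
      Set.indicator_of_notMem (by simpa using hn) F]
  exact Finset.sum_congr rfl fun n hn => (Set.indicator_of_mem (by simpa using hn) F).symm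

theorem natTwist_mul (t : ℝ) {m n : ℕ} (hm : m ≠ 0) (hn : n ≠ 0) :
    natTwist t (m * n) = natTwist t m * natTwist t n := by
  rw [natTwist, natTwist, natTwist, ← Complex.exp_add, Nat.cast_mul,
    Real.log_mul (by exact_mod_cast hm) (by exact_mod_cast hn)]
  congr 1
  push_cast
  ring

theorem sum_smoothKFree_mul_natTwist (hk : k ≠ 0) (α : ℂ) (N : ℕ) (t : ℝ) :
    ∑ n ∈ (smoothKFree_finite k N).toFinset,
      α ^ ArithmeticFunction.cardFactors n / (n : ℂ) * natTwist t n =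
        smoothEulerProduct k α N t := by
  rw [sum_smoothKFree_eq_prod hk N, smoothEulerProduct]
  · refine Finset.prod_congr rfl fun p hp => Finset.sum_congr rfl fun j _ => ?_
    rw [ArithmeticFunction.cardFactors_apply_prime (Nat.prime_of_mem_primesLE hp), pow_one]
  · simp [natTwist]
  · intro m n hm hn
    rw [ArithmeticFunction.cardFactors_mul hm hn, pow_add, Nat.cast_mul, natTwist_mul t hm hn]
    ring

theorem smoothSum_eq_sum (f : ℝ → ℂ) (k : ℕ) (α : ℂ) (N : ℕ) :
    smoothSum f k α N = ∑ n ∈ (smoothKFree_finite k N).toFinset,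
      f (Real.log n / Real.log N) * (α ^ ArithmeticFunction.cardFactors n / (n : ℂ)) :=
  finsum_mem_eq_finite_toFinset_sum _ _

theorem norm_smoothSum_le (hk : k ≠ 0) (α : ℂ) (N : ℕ) {f : ℝ → ℂ} {M : ℝ}
    (hf : ∀ x, ‖f x‖ ≤ M) :
    ‖smoothSum f k α N‖ ≤ M * ‖smoothEulerProduct k (‖α‖ : ℝ) N 0‖ := by
  have hreal : ∑ n ∈ (smoothKFree_finite k N).toFinset,
      ‖α‖ ^ ArithmeticFunction.cardFactors n / (n : ℝ) ≤
        ‖smoothEulerProduct k (‖α‖ : ℝ) N 0‖ := by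
    rw [← sum_smoothKFree_mul_natTwist hk]
    simp only [natTwist_zero_left, mul_one]
    exact_mod_cast Real.le_norm_self _
  have hM : 0 ≤ M := (norm_nonneg _).trans (hf 0)
  refine le_trans ?_ (mul_le_mul_of_nonneg_left hreal hM)
  rw [smoothSum_eq_sum, Finset.mul_sum]
  refine norm_sum_le_of_le _ fun n _ => ?_
  rw [norm_mul, norm_div, norm_pow, Complex.norm_natCast]
  gcongr
  exact hf _

end KFree

section FourierInversion

open scoped FourierTransform

/-- The inverse of the Fourier transform in the normalization of `fourierHat`. -/
noncomputable def fourierInvIntegral (g : ℝ → ℂ) (x : ℝ) : ℂ :=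
  ∫ t : ℝ, Complex.exp (Complex.I * (t * x : ℝ)) * g t

theorem fourierInvIntegral_eq_vectorFourier (g : ℝ → ℂ) :
    fourierInvIntegral g = VectorFourier.fourierIntegral Real.probChar volume (-innerₗ ℝ) g := by
  ext x
  rw [VectorFourier.fourierIntegral_probChar]
  refine integral_congr_ae (.of_forall fun t => ?_)
  simp [mul_comm]

theorem continuous_fourierInvIntegral {g : ℝ → ℂ} (hg : Integrable g) :
    Continuous (fourierInvIntegral g) := by
  rw [fourierInvIntegral_eq_vectorFourier]
  exact VectorFourier.fourierIntegral_continuous Real.continuous_probChar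
    (by simp only [LinearMap.neg_apply, innerₗ_apply_apply, RCLike.inner_apply,
      Real.ringHom_apply]; fun_prop) hg

theorem integral_fourierInvIntegral_mul {g h : ℝ → ℂ} (hg : Integrable g) (hh : Integrable h) :
    ∫ x, fourierInvIntegral g x * h x = ∫ t, g t * fourierInvIntegral h t := by
  rw [fourierInvIntegral_eq_vectorFourier, fourierInvIntegral_eq_vectorFourier]
  have hflip : (-innerₗ ℝ : ℝ →ₗ[ℝ] ℝ →ₗ[ℝ] ℝ).flip = -innerₗ ℝ := by
    ext; simp
  have key := VectorFourier.integral_fourierIntegral_smul_eq_flip (L := -innerₗ ℝ) (μ := volume)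
    (ν := volume) Real.continuous_probChar
    (by simp only [LinearMap.neg_apply, innerₗ_apply_apply, RCLike.inner_apply,
      Real.ringHom_apply]; fun_prop) hg hh
  rwa [hflip] at key

theorem fourierInvIntegral_eq_fourierInv (g : ℝ → ℂ) (x : ℝ) :
    fourierInvIntegral g x = 𝓕⁻ g (x / (2 * Real.pi)) := by
  rw [Real.fourierInv_eq', fourierInvIntegral]
  refine integral_congr_ae (.of_forall fun t => ?_)
  simp only [RCLike.inner_apply, conj_trivial, smul_eq_mul]
  congr 2
  push_cast
  field_simp

theorem fourierHat_comp_div_two_pi (g : ℝ → ℂ) :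
    fourierHat (fun t => g (t / (2 * Real.pi))) = 𝓕 g := by
  ext x
  have hscale := Measure.integral_comp_div
    (fun s : ℝ => Complex.exp (-(Complex.I * (2 * Real.pi * s : ℝ) * x)) * g s) (2 * Real.pi)
  simp only [mul_div_cancel₀ _ Real.two_pi_pos.ne', abs_of_pos Real.two_pi_pos,
    Complex.real_smul] at hscale
  rw [fourierHat, hscale, Real.fourier_real_eq_integral_exp_smul]
  push_cast
  rw [inv_mul_cancel_left₀ (by exact_mod_cast Real.two_pi_pos.ne')]
  refine integral_congr_ae (.of_forall fun s => ?_)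
  simp only [smul_eq_mul]
  congr 2
  ring

theorem exists_schwartzMap_eq_fourierInvIntegral (χ : 𝓢(ℝ, ℂ)) :
    ∃ ψ : 𝓢(ℝ, ℂ), ⇑ψ = fourierInvIntegral χ ∧ fourierHat ψ = χ := by
  let e : ℝ ≃L[ℝ] ℝ := ContinuousLinearEquiv.unitsEquivAut ℝ
    (Units.mk0 (2 * Real.pi)⁻¹ (inv_ne_zero Real.two_pi_pos.ne'))
  set ψ := SchwartzMap.compCLMOfContinuousLinearEquiv ℂ e (𝓕⁻ χ) with hψ
  have hψ_eq : ⇑ψ = fun t : ℝ => (𝓕⁻ χ) (t / (2 * Real.pi)) := by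
    ext t
    simp [hψ, e, div_eq_mul_inv]
  refine ⟨ψ, ?_, ?_⟩
  · ext t
    rw [hψ_eq, fourierInvIntegral_eq_fourierInv, SchwartzMap.fourierInv_coe]
  · rw [hψ_eq, fourierHat_comp_div_two_pi, ← SchwartzMap.fourier_coe,
      FourierTransform.fourier_fourierInv_eq]

theorem exists_schwartzMap_eq_one_nhds (x : ℝ) : ∃ ψ : 𝓢(ℝ, ℂ), ∀ᶠ y in 𝓝 x, ψ y = 1 := by
  let b : ContDiffBump x := ⟨1, 2, one_pos, one_lt_two⟩
  have hsupp : HasCompactSupport fun y => ((b y : ℝ) : ℂ) :=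
    b.hasCompactSupport.comp_left Complex.ofReal_zero
  refine ⟨hsupp.toSchwartzMap (Complex.ofRealCLM.contDiff.comp b.contDiff), ?_⟩
  filter_upwards [b.eventuallyEq_one] with y hy
  exact (congrArg Complex.ofReal hy).trans Complex.ofReal_one

theorem ae_eq_of_integral_mul_schwartzMap_eq {g g' : ℝ → ℂ} (hg : LocallyIntegrable g)
    (hg' : LocallyIntegrable g')
    (h : ∀ ψ : 𝓢(ℝ, ℂ), ∫ t, g t * ψ t = ∫ t, g' t * ψ t) : g =ᵐ[volume] g' := by
  refine ae_eq_of_integral_contDiff_smul_eq hg hg' fun χ hχ hsupp => ?_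
  have hsupp' : HasCompactSupport fun y => ((χ y : ℝ) : ℂ) := hsupp.comp_left Complex.ofReal_zero
  have hψ := h (hsupp'.toSchwartzMap (Complex.ofRealCLM.contDiff.comp hχ))
  simp only [Complex.real_smul, mul_comm ((χ _ : ℝ) : ℂ)]
  exact hψ

theorem IsFourierTransform.locallyIntegrable {f g : ℝ → ℂ} (h : IsFourierTransform f g) :
    LocallyIntegrable g := by
  intro x
  obtain ⟨ψ, hψ⟩ := exists_schwartzMap_eq_one_nhds x
  obtain ⟨U, hU, hUo, hxU⟩ := eventually_nhds_iff.1 hψ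
  refine ⟨U, hUo.mem_nhds hxU, ?_⟩
  refine ((h ψ).1.integrableOn (s := U)).congr_fun (fun y hy => ?_) hUo.measurableSet
  simp only [hU y hy, mul_one]

theorem IsFourierTransform.ae_eq {f g g' : ℝ → ℂ} (h : IsFourierTransform f g)
    (h' : IsFourierTransform f g') : g =ᵐ[volume] g' :=
  ae_eq_of_integral_mul_schwartzMap_eq h.locallyIntegrable h'.locallyIntegrable fun ψ =>
    (h ψ).2.2.trans (h' ψ).2.2.symm

theorem IsFourierTransform.eq_fourierInvIntegral {f g : ℝ → ℂ} (h : IsFourierTransform f g)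
    (hf : Continuous f) (hg : Integrable g) : f = fourierInvIntegral g := by
  have hcont := continuous_fourierInvIntegral hg
  refine (Continuous.ae_eq_iff_eq volume hf hcont).1 (ae_eq_of_integral_mul_schwartzMap_eq
    hf.locallyIntegrable hcont.locallyIntegrable fun χ => ?_)
  obtain ⟨ψ, hψ, hψχ⟩ := exists_schwartzMap_eq_fourierInvIntegral χ
  rw [integral_fourierInvIntegral_mul hg χ.integrable, ← hψ, (h ψ).2.2, hψχ]

theorem smoothSum_fourierInvIntegral {k : ℕ} (hk : k ≠ 0) (α : ℂ) (N : ℕ) {g : ℝ → ℂ}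
    (hg : Integrable g) :
    smoothSum (fourierInvIntegral g) k α N =
      ∫ t : ℝ, smoothEulerProduct k α N (t / Real.log N) * g t := by
  have hint (x : ℝ) : Integrable fun t : ℝ => Complex.exp (Complex.I * (t * x : ℝ)) * g t :=
    hg.bdd_mul (by fun_prop) (.of_forall fun t => (Complex.norm_exp_I_mul_ofReal (t * x)).le)
  simp only [smoothSum_eq_sum, fourierInvIntegral, ← integral_mul_const]
  rw [← integral_finsetSum _ fun n _ => (hint _).mul_const _]
  refine integral_congr_ae (.of_forall fun t => ?_)
  simp only [← sum_smoothKFree_mul_natTwist hk, Finset.sum_mul]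
  refine Finset.sum_congr rfl fun n _ => ?_
  rw [natTwist, show t / Real.log N * Real.log n = t * (Real.log n / Real.log N) by ring]
  ring

end FourierInversion

section PowerIntegrals

theorem one_div_one_add_rpow_le (η t : ℝ) :
    1 / (1 + |t| ^ η) ≤ 2 ^ |η| * (1 + |t|) ^ (-η) := by
  have habs : 0 ≤ |t| := abs_nonneg t
  have hpow : 0 ≤ |t| ^ η := Real.rpow_nonneg habs η
  have htwo : (1 : ℝ) ≤ 2 ^ |η| := Real.one_le_rpow one_le_two (abs_nonneg η)
  rw [Real.rpow_neg (by positivity), ← div_eq_mul_inv, div_le_div_iff₀ (by positivity)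
    (by positivity), one_mul]
  rcases le_total η 0 with hη | hη
  · calc (1 + |t|) ^ η ≤ 1 := Real.rpow_le_one_of_one_le_of_nonpos (by linarith) hη
      _ ≤ _ := one_le_mul_of_one_le_of_one_le htwo (by linarith)
  rw [abs_of_nonneg hη] at htwo ⊢
  rcases le_total |t| 1 with ht | ht
  · calc (1 + |t|) ^ η ≤ 2 ^ η := Real.rpow_le_rpow (by positivity) (by linarith) hη
      _ ≤ _ := le_mul_of_one_le_right (by positivity) (by linarith)
  · calc (1 + |t|) ^ η ≤ (2 * |t|) ^ η := Real.rpow_le_rpow (by positivity) (by linarith) hη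
      _ = 2 ^ η * |t| ^ η := Real.mul_rpow zero_le_two habs
      _ ≤ _ := by gcongr; linarith

theorem setOf_abs_le_eq_Icc (R : ℝ) : {t : ℝ | |t| ≤ R} = Set.Icc (-R) R := by
  ext t
  simp only [Set.mem_ofPred_eq, Set.mem_Icc, abs_le]

theorem measurableSet_abs_le (R : ℝ) : MeasurableSet {t : ℝ | |t| ≤ R} := by
  rw [setOf_abs_le_eq_Icc]
  exact measurableSet_Icc

theorem integrableOn_one_add_abs_rpow (s R : ℝ) :
    IntegrableOn (fun t : ℝ => (1 + |t|) ^ s) {t : ℝ | |t| ≤ R} := by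
  rw [setOf_abs_le_eq_Icc]
  exact (Continuous.rpow_const (by fun_prop) fun t => .inl (by positivity)).integrableOn_Icc

theorem integrable_one_add_abs_rpow {s : ℝ} (hs : 1 < s) :
    Integrable fun t : ℝ => (1 + |t|) ^ (-s) :=
  integrable_one_add_norm (E := ℝ) (by simpa using hs)

theorem rpow_le_two_rpow_abs_mul_max {x R : ℝ} (hx : 1 ≤ x) (hxR : x ≤ 2 * R) (hR : 0 ≤ R)
    (c : ℝ) : x ^ c ≤ 2 ^ |c| * max 1 (R ^ c) := by
  have htwo : (1 : ℝ) ≤ 2 ^ |c| := Real.one_le_rpow one_le_two (abs_nonneg c)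
  rcases le_total c 0 with hc | hc
  · calc x ^ c ≤ 1 := Real.rpow_le_one_of_one_le_of_nonpos hx hc
      _ ≤ _ := one_le_mul_of_one_le_of_one_le htwo (le_max_left _ _)
  · calc x ^ c ≤ (2 * R) ^ c := Real.rpow_le_rpow (by linarith) hxR hc
      _ = 2 ^ |c| * R ^ c := by rw [Real.mul_rpow zero_le_two hR, abs_of_nonneg hc]
      _ ≤ _ := by gcongr; exact le_max_right _ _

-- The loss `R ^ δ` absorbs the logarithm that appears for `s = 1`.
theorem exists_setIntegral_one_add_abs_rpow_le (s : ℝ) {δ : ℝ} (hδ : 0 < δ) :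
    ∃ K : ℝ, 0 ≤ K ∧ ∀ R : ℝ, 1 ≤ R →
      ∫ t in {t : ℝ | |t| ≤ R}, (1 + |t|) ^ (-s) ≤ K * max 1 (R ^ (1 - s + δ)) := by
  set c := 1 - s + δ with hc
  set J := ∫ t : ℝ, (1 + |t|) ^ (-(1 + δ))
  have hJ := integrable_one_add_abs_rpow (s := 1 + δ) (by linarith)
  have hnonneg (t : ℝ) : 0 ≤ (1 + |t|) ^ (-(1 + δ)) := by positivity
  refine ⟨J * 2 ^ |c|, mul_nonneg (integral_nonneg hnonneg) (by positivity), fun R hR => ?_⟩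
  calc ∫ t in {t : ℝ | |t| ≤ R}, (1 + |t|) ^ (-s)
      ≤ ∫ t in {t : ℝ | |t| ≤ R}, (1 + |t|) ^ (-(1 + δ)) * (2 ^ |c| * max 1 (R ^ c)) := by
        refine setIntegral_mono_on (integrableOn_one_add_abs_rpow _ R)
          (hJ.mul_const _).integrableOn (measurableSet_abs_le R) fun t ht => ?_
        have hsplit : (1 + |t|) ^ (-s) = (1 + |t|) ^ (-(1 + δ)) * (1 + |t|) ^ c := by
          rw [← Real.rpow_add (by positivity), hc, show -(1 + δ) + (1 - s + δ) = -s by ring]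
        have ht' : |t| ≤ R := ht
        rw [hsplit]
        exact mul_le_mul_of_nonneg_left (rpow_le_two_rpow_abs_mul_max
          (by linarith [abs_nonneg t]) (by linarith) (by linarith) c) (hnonneg t)
    _ ≤ J * (2 ^ |c| * max 1 (R ^ c)) := by
        rw [integral_mul_const]
        gcongr
        exact setIntegral_le_integral hJ (.of_forall hnonneg)
    _ = J * 2 ^ |c| * max 1 (R ^ c) := by ring

theorem exists_norm_setIntegral_le_of_norm_le (s : ℝ) {δ : ℝ} (hδ : 0 < δ) :
    ∃ K : ℝ, 0 ≤ K ∧ ∀ (R B : ℝ) (F : ℝ → ℂ), 1 ≤ R → 0 ≤ B →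
      (∀ t, |t| ≤ R → ‖F t‖ ≤ B * (1 + |t|) ^ (-s)) →
        ‖∫ t in {t : ℝ | |t| ≤ R}, F t‖ ≤ B * K * max 1 (R ^ (1 - s + δ)) := by
  obtain ⟨K, hK, h⟩ := exists_setIntegral_one_add_abs_rpow_le s hδ
  refine ⟨K, hK, fun R B F hR hB hF => ?_⟩
  calc ‖∫ t in {t : ℝ | |t| ≤ R}, F t‖
      ≤ ∫ t in {t : ℝ | |t| ≤ R}, B * (1 + |t|) ^ (-s) :=
        norm_integral_le_of_norm_le ((integrableOn_one_add_abs_rpow _ R).const_mul B)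
          ((ae_restrict_mem (measurableSet_abs_le R)).mono hF)
    _ ≤ B * (K * max 1 (R ^ (1 - s + δ))) := by
        rw [integral_const_mul]
        gcongr
        exact h R hR
    _ = B * K * max 1 (R ^ (1 - s + δ)) := (mul_assoc _ _ _).symm

theorem setIntegral_one_add_abs_rpow_tail_le {η : ℝ} (hη : 1 < η) {R : ℝ} (hR : 0 < R) :
    ∫ t in {t : ℝ | |t| ≤ R}ᶜ, (1 + |t|) ^ (-η) ≤ 2 / (η - 1) * R ^ (1 - η) := by
  set F : ℝ → ℝ := (Set.Ioi R).indicator fun x => (1 + x) ^ (-η) with hF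
  have hfold : ∫ t in {t : ℝ | |t| ≤ R}ᶜ, (1 + |t|) ^ (-η) = ∫ t : ℝ, F |t| := by
    rw [← integral_indicator (measurableSet_abs_le R).compl]
    refine integral_congr_ae (.of_forall fun t => ?_)
    simp [F, Set.indicator_apply]
  have hhalf : ∫ t in Set.Ioi (0 : ℝ), F t = ∫ t in Set.Ioi R, (1 + t) ^ (-η) := by
    rw [hF, setIntegral_indicator measurableSet_Ioi, Set.Ioi_inter_Ioi, max_eq_right hR.le]
  have hbound : ∫ t in Set.Ioi R, (1 + t) ^ (-η) ≤ ∫ t in Set.Ioi R, t ^ (-η) := by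
    refine integral_mono_of_nonneg ?_ (integrableOn_Ioi_rpow_of_lt (by linarith) hR) ?_ <;>
      filter_upwards [ae_restrict_mem measurableSet_Ioi] with t ht
    · exact Real.rpow_nonneg (by linarith [hR.trans ht]) _
    · exact Real.rpow_le_rpow_of_nonpos (hR.trans ht) (by linarith) (by linarith)
  calc ∫ t in {t : ℝ | |t| ≤ R}ᶜ, (1 + |t|) ^ (-η)
      = 2 * ∫ t in Set.Ioi R, (1 + t) ^ (-η) := by rw [hfold, integral_comp_abs, hhalf]
    _ ≤ 2 * ∫ t in Set.Ioi R, t ^ (-η) := by gcongr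
    _ = 2 / (η - 1) * R ^ (1 - η) := by
        rw [integral_Ioi_rpow_of_lt (by linarith) hR, show -η + 1 = -(η - 1) by ring,
          neg_div_neg_eq, show -(η - 1) = 1 - η by ring]
        ring

end PowerIntegrals

section ErrorBound

/-- The sum of the two error terms of the theorem, `log log N / log N` coming from
`|t| ≤ cutoff N` and the other one, in which `a` stands for `‖α‖ - α.re`, from the tail. -/
noncomputable def errorBound (a η : ℝ) (N : ℕ) : ℝ :=
  Real.log (Real.log N) / Real.log N +
    Real.log (Real.log N) ^ (η - 1) / Real.log N ^ (η - (a + 1))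

variable {a η : ℝ} {N : ℕ}

theorem one_le_log_of_one_le_log_log (h : 1 ≤ Real.log (Real.log N)) : 1 ≤ Real.log N :=
  (Real.one_le_exp zero_le_one).trans (exp_one_le_log_of_one_le_log_log h)

theorem cutoff_rpow_mul_log_log_rpow (h : 1 ≤ Real.log (Real.log N)) :
    cutoff N ^ (a + 1 - η) * Real.log (Real.log N) ^ a =
      Real.log (Real.log N) ^ (η - 1) / Real.log N ^ (η - (a + 1)) := by
  have hL : 0 < Real.log N := one_pos.trans_le (one_le_log_of_one_le_log_log h)
  have hℓ : 0 < Real.log (Real.log N) := one_pos.trans_le h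
  rw [cutoff, Real.div_rpow hL.le hℓ.le, div_mul_eq_mul_div, mul_div_assoc,
    ← Real.rpow_sub hℓ, show η - (a + 1) = -(a + 1 - η) by ring, Real.rpow_neg hL.le,
    div_inv_eq_mul, mul_comm, show a - (a + 1 - η) = η - 1 by ring]

theorem errorBound_eq (h : 1 ≤ Real.log (Real.log N)) :
    errorBound a η N =
      (cutoff N)⁻¹ + cutoff N ^ (a + 1 - η) * Real.log (Real.log N) ^ a := by
  rw [errorBound, cutoff_rpow_mul_log_log_rpow h, cutoff, inv_div]

theorem inv_cutoff_add_rpow_le_errorBound (ha : 0 ≤ a) (h : 1 ≤ Real.log (Real.log N)) :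
    (cutoff N)⁻¹ + cutoff N ^ (a + 1 - η) ≤ errorBound a η N := by
  have hR := one_pos.trans_le (one_le_cutoff h)
  rw [errorBound_eq h]
  gcongr
  exact le_mul_of_one_le_right (by positivity) (Real.one_le_rpow h ha)

theorem cutoff_rpow_mul_log_rpow_le_errorBound (h : 1 ≤ Real.log (Real.log N)) :
    cutoff N ^ (1 - η) * Real.log N ^ a ≤ errorBound a η N := by
  have hR := one_pos.trans_le (one_le_cutoff h)
  have hℓ : 0 < Real.log (Real.log N) := one_pos.trans_le h
  have hpow : Real.log N ^ a = cutoff N ^ a * Real.log (Real.log N) ^ a := by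
    rw [← Real.mul_rpow hR.le hℓ.le, cutoff, div_mul_cancel₀ _ hℓ.ne']
  rw [errorBound_eq h]
  calc cutoff N ^ (1 - η) * Real.log N ^ a
      = cutoff N ^ (a + 1 - η) * Real.log (Real.log N) ^ a := by
        rw [hpow, ← mul_assoc, ← Real.rpow_add hR, show 1 - η + a = a + 1 - η by ring]
    _ ≤ _ := le_add_of_nonneg_left (by positivity)

theorem tendsto_log_natCast : Tendsto (fun N : ℕ => Real.log N) atTop atTop :=
  Real.tendsto_log_atTop.comp tendsto_natCast_atTop_atTop

theorem eventually_one_le_log_log : ∀ᶠ N : ℕ in atTop, 1 ≤ Real.log (Real.log N) :=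
  (Real.tendsto_log_atTop.comp tendsto_log_natCast).eventually_ge_atTop 1

theorem tendsto_log_log_rpow_div_log_rpow (r : ℝ) {s : ℝ} (hs : 0 < s) :
    Tendsto (fun N : ℕ => Real.log (Real.log N) ^ r / Real.log N ^ s) atTop (𝓝 0) :=
  (isLittleO_log_rpow_rpow_atTop r hs).tendsto_div_nhds_zero.comp tendsto_log_natCast

theorem tendsto_errorBound (h : a + 1 < η) : Tendsto (errorBound a η) atTop (𝓝 0) := by
  have hinner := tendsto_log_log_rpow_div_log_rpow 1 one_pos
  simp only [Real.rpow_one] at hinner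
  have houter := tendsto_log_log_rpow_div_log_rpow (η - 1) (sub_pos.2 h)
  rw [← add_zero 0]
  exact hinner.add houter

theorem errorBound_isBigO_of_lt (h : a + 2 < η) :
    errorBound a η =O[atTop] fun N : ℕ => Real.log (Real.log N) / Real.log N := by
  refine (isBigO_refl _ _).add ?_
  have hratio := (tendsto_log_log_rpow_div_log_rpow (η - 2) (sub_pos.2 h)).isBigO_one ℝ
  refine ((isBigO_refl _ _).mul hratio).congr' ?_ (.of_forall fun N => mul_one _)
  filter_upwards [eventually_one_le_log_log] with N hN
  have hL : 0 < Real.log N := one_pos.trans_le (one_le_log_of_one_le_log_log hN)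
  rw [show η - 1 = 1 + (η - 2) by ring, show η - (a + 1) = 1 + (η - (a + 2)) by ring,
    Real.rpow_add (one_pos.trans_le hN), Real.rpow_add hL, Real.rpow_one, Real.rpow_one,
    mul_div_mul_comm]

theorem errorBound_isBigO_of_le (ha : 0 ≤ a) (h : η ≤ a + 2) :
    errorBound a η =O[atTop] fun N : ℕ =>
      Real.log (Real.log N) ^ (η - 1) / Real.log N ^ (η - (a + 1)) := by
  refine IsBigO.add (.of_bound 1 ?_) (isBigO_refl _ _)
  filter_upwards [eventually_one_le_log_log] with N hN
  have hR := one_le_cutoff hN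
  have hle : (cutoff N)⁻¹ ≤ cutoff N ^ (a + 1 - η) * Real.log (Real.log N) ^ a := by
    rw [← Real.rpow_neg_one]
    exact (Real.rpow_le_rpow_of_exponent_le hR (by linarith)).trans
      (le_mul_of_one_le_right (by positivity) (Real.one_le_rpow hN ha))
  rw [← inv_div, ← cutoff, one_mul, ← cutoff_rpow_mul_log_log_rpow hN,
    Real.norm_of_nonneg (by positivity)]
  exact hle.trans (Real.le_norm_self _)

end ErrorBound

section ErrorTerm

variable {k : ℕ} {α : ℂ} {η A : ℝ} {f g : ℝ → ℂ}

theorem isBigO_errorBound_of_norm_le {F : ℕ → ℂ} {K a : ℝ}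
    (h : ∀ N : ℕ, 1 ≤ Real.log (Real.log N) → ‖F N‖ ≤ K * errorBound a η N) :
    F =O[atTop] errorBound a η := by
  refine .of_bound |K| (eventually_one_le_log_log.mono fun N hN => (h N hN).trans ?_)
  rw [Real.norm_eq_abs, ← abs_mul]
  exact le_abs_self _

theorem setIntegral_normalizedEulerProduct_sub_mul_isBigO (hk : 2 ≤ k) (hα0 : α ≠ 0)
    (hα : ‖α‖ < 2) (hg : ∀ t, ‖g t‖ ≤ A * (1 + |t|) ^ (-η)) :
    (fun N => ∫ t in {t : ℝ | |t| ≤ cutoff N},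
      (normalizedEulerProduct k α N t - dickmanChar α t) * g t)
        =O[atTop] errorBound (‖α‖ - α.re) η := by
  obtain ⟨K, hK, hE⟩ := exists_norm_normalizedEulerProduct_sub_dickmanChar_le hk hα
  obtain ⟨K', hK', hint⟩ :=
    exists_norm_setIntegral_le_of_norm_le (α.re - 1 + η) (norm_pos_iff.2 hα0)
  have hA : 0 ≤ A := by simpa using (norm_nonneg _).trans (hg 0)
  refine isBigO_errorBound_of_norm_le (K := K * A * K') fun N hN => ?_
  have hR := one_le_cutoff hN
  have hbound (t : ℝ) (ht : |t| ≤ cutoff N) :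
      ‖(normalizedEulerProduct k α N t - dickmanChar α t) * g t‖ ≤
        K * A / cutoff N * (1 + |t|) ^ (-(α.re - 1 + η)) := by
    have hpow : (1 + |t|) ^ (-(α.re - 1 + η)) = (1 + |t|) ^ (1 - α.re) * (1 + |t|) ^ (-η) := by
      rw [← Real.rpow_add (by positivity)]
      ring_nf
    rw [norm_mul, hpow]
    calc _ ≤ K * (1 + |t|) ^ (1 - α.re) / cutoff N * (A * (1 + |t|) ^ (-η)) := by
          gcongr
          exacts [hE N t hN ht, hg t]
      _ = _ := by ring
  have hmax : max 1 (cutoff N ^ (1 - (α.re - 1 + η) + ‖α‖)) ≤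
      cutoff N * ((cutoff N)⁻¹ + cutoff N ^ (‖α‖ - α.re + 1 - η)) := by
    rw [mul_add, mul_inv_cancel₀ (by positivity), mul_comm (cutoff N),
      ← Real.rpow_add_one (by positivity),
      show ‖α‖ - α.re + 1 - η + 1 = 1 - (α.re - 1 + η) + ‖α‖ by ring]
    exact max_le_add_of_nonneg zero_le_one (by positivity)
  calc _ ≤ K * A / cutoff N * K' *
          (cutoff N * ((cutoff N)⁻¹ + cutoff N ^ (‖α‖ - α.re + 1 - η))) :=
        (hint _ _ _ hR (by positivity) hbound).trans (by gcongr)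
    _ = K * A * K' * ((cutoff N)⁻¹ + cutoff N ^ (‖α‖ - α.re + 1 - η)) := by field_simp
    _ ≤ _ := by
        gcongr
        exact inv_cutoff_add_rpow_le_errorBound (sub_nonneg.2 (Complex.re_le_norm α)) hN

theorem setIntegral_compl_normalizedEulerProduct_mul_isBigO (hk : 2 ≤ k) (hα : ‖α‖ < 2)
    (hη : 1 < η) (hg : ∀ t, ‖g t‖ ≤ A * (1 + |t|) ^ (-η)) :
    (fun N => ∫ t in {t : ℝ | |t| ≤ cutoff N}ᶜ, normalizedEulerProduct k α N t * g t)
      =O[atTop] errorBound (‖α‖ - α.re) η := by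
  obtain ⟨K, hK, hE⟩ := exists_norm_normalizedEulerProduct_le hk hα
  have hA : 0 ≤ A := by simpa using (norm_nonneg _).trans (hg 0)
  have : 0 < η - 1 := sub_pos.2 hη
  refine isBigO_errorBound_of_norm_le (K := K * A * (2 / (η - 1))) fun N hN => ?_
  have : 0 ≤ Real.log N := Real.log_natCast_nonneg N
  have hbound (t : ℝ) : ‖normalizedEulerProduct k α N t * g t‖ ≤
      K * Real.log N ^ (‖α‖ - α.re) * A * (1 + |t|) ^ (-η) := by
    rw [norm_mul, mul_assoc _ A]
    gcongr
    exacts [hE N t hN, hg t]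
  calc _ ≤ ∫ t in {t : ℝ | |t| ≤ cutoff N}ᶜ,
          K * Real.log N ^ (‖α‖ - α.re) * A * (1 + |t|) ^ (-η) :=
        norm_integral_le_of_norm_le ((integrable_one_add_abs_rpow hη).const_mul _).integrableOn
          (.of_forall hbound)
    _ ≤ K * Real.log N ^ (‖α‖ - α.re) * A * (2 / (η - 1) * cutoff N ^ (1 - η)) := by
        rw [integral_const_mul]
        gcongr
        exact setIntegral_one_add_abs_rpow_tail_le hη (one_pos.trans_le (one_le_cutoff hN))
    _ = K * A * (2 / (η - 1)) * (cutoff N ^ (1 - η) * Real.log N ^ (‖α‖ - α.re)) := by ring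
    _ ≤ _ := by
        gcongr
        exact cutoff_rpow_mul_log_rpow_le_errorBound hN

theorem setIntegral_dickmanChar_mul_isBigO (hα0 : α ≠ 0) (hη : η ≤ 1)
    (hg : ∀ t, ‖g t‖ ≤ A * (1 + |t|) ^ (-η)) :
    (fun N => ∫ t in {t : ℝ | |t| ≤ cutoff N}, dickmanChar α t * g t)
      =O[atTop] errorBound (‖α‖ - α.re) η := by
  obtain ⟨K, hK, hint⟩ :=
    exists_norm_setIntegral_le_of_norm_le (α.re + η) (norm_pos_iff.2 hα0)
  have hA : 0 ≤ A := by simpa using (norm_nonneg _).trans (hg 0)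
  have ha : 0 ≤ ‖α‖ - α.re := sub_nonneg.2 (Complex.re_le_norm α)
  refine isBigO_errorBound_of_norm_le (K := Real.exp (4 * ‖α‖) * A * K) fun N hN => ?_
  have hR := one_le_cutoff hN
  have hbound (t : ℝ) : ‖dickmanChar α t * g t‖ ≤
      Real.exp (4 * ‖α‖) * A * (1 + |t|) ^ (-(α.re + η)) := by
    rw [norm_mul, neg_add, Real.rpow_add (by positivity)]
    calc _ ≤ Real.exp (4 * ‖α‖) * (1 + |t|) ^ (-α.re) * (A * (1 + |t|) ^ (-η)) := by
          gcongr
          exacts [norm_dickmanChar_le α t, hg t]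
      _ = _ := by ring
  have hmax : max 1 (cutoff N ^ (1 - (α.re + η) + ‖α‖)) ≤ errorBound (‖α‖ - α.re) η N := by
    rw [show 1 - (α.re + η) + ‖α‖ = ‖α‖ - α.re + 1 - η by ring,
      max_eq_right (Real.one_le_rpow hR (by linarith))]
    exact (le_add_of_nonneg_left (by positivity)).trans (inv_cutoff_add_rpow_le_errorBound ha hN)
  exact (hint _ _ _ hR (by positivity) fun t _ => hbound t).trans (by gcongr)

theorem smoothSum_div_isBigO (hk : 2 ≤ k) (hα : ‖α‖ < 2) (hη : η ≤ 1)
    (hf : ∃ M : ℝ, ∀ x, ‖f x‖ ≤ M) :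
    (fun N => smoothSum f k α N / (smoothConst k α * (Real.log N : ℂ) ^ α))
      =O[atTop] errorBound (‖α‖ - α.re) η := by
  obtain ⟨M, hM⟩ := hf
  obtain ⟨K, hK, hE⟩ := exists_norm_smoothEulerProduct_div_le hk hα
  have hM0 : 0 ≤ M := (norm_nonneg _).trans (hM 0)
  refine isBigO_errorBound_of_norm_le (K := M * K) fun N hN => ?_
  have : 0 ≤ Real.log N := Real.log_natCast_nonneg N
  calc _ ≤ M * (‖smoothEulerProduct k (‖α‖ : ℝ) N 0‖ /
          ‖smoothConst k α * (Real.log N : ℂ) ^ α‖) := by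
        rw [norm_div, ← mul_div_assoc]
        gcongr
        exact norm_smoothSum_le (by lia) α N hM
    _ ≤ M * (K * (cutoff N ^ (1 - η) * Real.log N ^ (‖α‖ - α.re))) := by
        gcongr
        exact (hE N hN).trans (by
          gcongr
          exact le_mul_of_one_le_left (by positivity)
            (Real.one_le_rpow (one_le_cutoff hN) (sub_nonneg.2 hη)))
    _ ≤ M * (K * errorBound (‖α‖ - α.re) η N) := by
        gcongr
        exact cutoff_rpow_mul_log_rpow_le_errorBound hN
    _ = _ := (mul_assoc _ _ _).symm

/-- The quantity `ε_N` of the theorem, for the constant `C = smoothConst k α`. -/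
noncomputable def smoothSumError (f g : ℝ → ℂ) (k : ℕ) (α : ℂ) (N : ℕ) : ℂ :=
  smoothSum f k α N / (smoothConst k α * (Real.log N : ℂ) ^ α) -
    ∫ t in {t : ℝ | |t| ≤ cutoff N}, dickmanChar α t * g t

theorem smoothSum_eq_mul_add_smoothSumError (f g : ℝ → ℂ) (k : ℕ) (α : ℂ) {N : ℕ}
    (hN : 2 ≤ N) :
    smoothSum f k α N = smoothConst k α * (Real.log N : ℂ) ^ α *
      ((∫ t in {t : ℝ | |t| ≤ cutoff N}, dickmanChar α t * g t) + smoothSumError f g k α N) := by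
  rw [smoothSumError, add_sub_cancel, mul_div_cancel₀]
  exact smoothConst_mul_log_cpow_ne_zero (Real.log_pos (by exact_mod_cast hN))

theorem smoothSumError_congr {g' : ℝ → ℂ} (h : g =ᵐ[volume] g') :
    smoothSumError f g k α = smoothSumError f g' k α := by
  ext N
  rw [smoothSumError, smoothSumError,
    integral_congr_ae (ae_restrict_of_ae (h.mono fun t ht => congrArg (dickmanChar α t * ·) ht))]

theorem integrable_normalizedEulerProduct_mul (k : ℕ) (α : ℂ) (N : ℕ) (hg : Integrable g) :
    Integrable fun t => normalizedEulerProduct k α N t * g t :=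
  hg.bdd_mul (continuous_normalizedEulerProduct k α N).aestronglyMeasurable
    (.of_forall fun t => norm_normalizedEulerProduct_le k α N t)

theorem smoothSumError_fourierInvIntegral (hk : k ≠ 0) (α : ℂ) (N : ℕ) (hg : Integrable g) :
    smoothSumError (fourierInvIntegral g) g k α N =
      (∫ t in {t : ℝ | |t| ≤ cutoff N},
        (normalizedEulerProduct k α N t - dickmanChar α t) * g t) +
      ∫ t in {t : ℝ | |t| ≤ cutoff N}ᶜ, normalizedEulerProduct k α N t * g t := by
  have hE := integrable_normalizedEulerProduct_mul k α N hg
  have hφ : IntegrableOn (fun t => dickmanChar α t * g t) {t : ℝ | |t| ≤ cutoff N} := by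
    rw [setOf_abs_le_eq_Icc]
    exact hg.integrableOn.continuousOn_mul (continuous_dickmanChar α).continuousOn isCompact_Icc
  have hsum : smoothSum (fourierInvIntegral g) k α N /
      (smoothConst k α * (Real.log N : ℂ) ^ α) = ∫ t, normalizedEulerProduct k α N t * g t := by
    rw [smoothSum_fourierInvIntegral hk α N hg, ← integral_div]
    simp only [normalizedEulerProduct, div_mul_eq_mul_div]
  simp only [sub_mul]
  rw [integral_sub hE.integrableOn hφ, smoothSumError, hsum,
    ← integral_add_compl (measurableSet_abs_le (cutoff N)) hE]
  ring

theorem smoothSumError_fourierInvIntegral_isBigO (hk : 2 ≤ k) (hα0 : α ≠ 0) (hα : ‖α‖ < 2)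
    (hη : 1 < η) (hg : ∀ t, ‖g t‖ ≤ A * (1 + |t|) ^ (-η)) (hgi : Integrable g) :
    smoothSumError (fourierInvIntegral g) g k α =O[atTop] errorBound (‖α‖ - α.re) η := by
  rw [show smoothSumError (fourierInvIntegral g) g k α = _ from
    funext fun N => smoothSumError_fourierInvIntegral (by lia) α N hgi]
  exact (setIntegral_normalizedEulerProduct_sub_mul_isBigO hk hα0 hα hg).add
    (setIntegral_compl_normalizedEulerProduct_mul_isBigO hk hα hη hg)

theorem smoothSumError_isBigO (hk : 2 ≤ k) (hα0 : α ≠ 0) (hα : ‖α‖ < 2)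
    (hbdd : η ≤ 1 → ∃ M : ℝ, ∀ x, ‖f x‖ ≤ M) (hcont : 1 < η → Continuous f)
    (hdecay : f ∈ fourierDecay η) (hfg : IsFourierTransform f g) :
    smoothSumError f g k α =O[atTop] errorBound (‖α‖ - α.re) η := by
  obtain ⟨g₀, hfg₀, A, hA, hg₀⟩ := hdecay
  rw [smoothSumError_congr (hfg.ae_eq hfg₀)]
  have hbound (t : ℝ) : ‖g₀ t‖ ≤ A * 2 ^ |η| * (1 + |t|) ^ (-η) := by
    refine (hg₀ t).trans ?_
    rw [div_eq_mul_one_div, mul_assoc]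
    gcongr
    exact one_div_one_add_rpow_le η t
  rcases le_or_gt η 1 with hη | hη
  · exact (smoothSum_div_isBigO hk hα hη (hbdd hη)).sub
      (setIntegral_dickmanChar_mul_isBigO hα0 hη hbound)
  · have hint : Integrable g₀ := ((integrable_one_add_abs_rpow hη).const_mul _).mono'
      hfg₀.locallyIntegrable.aestronglyMeasurable (.of_forall hbound)
    rw [hfg₀.eq_fourierInvIntegral (hcont hη) hint]
    exact smoothSumError_fourierInvIntegral_isBigO hk hα0 hα hη hbound hint

end ErrorTerm

theorem corollary1_general (k : ℕ) (hk : 2 ≤ k) (α : ℂ) (hα0 : α ≠ 0) (hα : ‖α‖ < 2) :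
    ∃ C : ℂ, C ≠ 0 ∧
      ∀ (η : ℝ) (f fhat : ℝ → ℂ), (η ≤ 1 → ∃ M : ℝ, ∀ x : ℝ, ‖f x‖ ≤ M) →
        (1 < η → Continuous f) → f ∈ fourierDecay η → IsFourierTransform f fhat →
        ∃ ε : ℕ → ℂ,
          (∀ N : ℕ, 2 ≤ N →
            smoothSum f k α N = C * (Real.log N : ℂ) ^ α *
              ((∫ t in {t : ℝ | |t| ≤ cutoff N}, dickmanChar α t * fhat t) + ε N)) ∧
          (‖α‖ - α.re + 1 < η → Tendsto ε atTop (𝓝 0)) ∧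
          (‖α‖ - α.re + 2 < η →
            ε =O[atTop] fun N : ℕ => Real.log (Real.log N) / Real.log N) ∧
          (η ≤ ‖α‖ - α.re + 2 →
            ε =O[atTop] fun N : ℕ =>
              Real.log (Real.log N) ^ (η - 1) / Real.log N ^ (η - (‖α‖ - α.re + 1))) := by
  refine ⟨smoothConst k α, smoothConst_ne_zero k α, fun η f fhat hbdd hcont hdecay hfhat => ?_⟩
  have hε := smoothSumError_isBigO hk hα0 hα hbdd hcont hdecay hfhat
  exact ⟨smoothSumError f fhat k α,
    fun _ => smoothSum_eq_mul_add_smoothSumError f fhat k α,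
    fun hη => hε.trans_tendsto (tendsto_errorBound hη),
    fun hη => hε.trans (errorBound_isBigO_of_lt hη),
    fun hη => hε.trans (errorBound_isBigO_of_le (sub_nonneg.2 (Complex.re_le_norm α)) hη)⟩

theorem corollary1 (k : ℕ) (hk : 2 ≤ k) (α : ℂ) (hα0 : α ≠ 0) (hα : ‖α‖ < 2) :
    ∃ C : ℂ, C ≠ 0 ∧
      ∀ (η : ℝ) (f fhat : ℝ → ℂ), ‖α‖ - α.re < η →
        (∃ M : ℝ, ∀ x : ℝ, ‖f x‖ ≤ M) → (1 < η → Continuous f) →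
        f ∈ fourierDecay η → IsFourierTransform f fhat →
        ∃ ε : ℕ → ℂ,
          (∀ N : ℕ, 2 ≤ N →
            smoothSum f k α N = C * (Real.log N : ℂ) ^ α *
              ((∫ t in {t : ℝ | |t| ≤ cutoff N}, dickmanChar α t * fhat t) + ε N)) ∧
          (‖α‖ - α.re + 1 < η → Filter.Tendsto ε Filter.atTop (nhds 0)) ∧
          (‖α‖ - α.re + 2 < η →
            ε =O[Filter.atTop] fun N : ℕ => Real.log (Real.log N) / Real.log N) ∧
          (η ≤ ‖α‖ - α.re + 2 →
            ε =O[Filter.atTop] fun N : ℕ =>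
              Real.log (Real.log N) ^ (η - 1) /
                Real.log N ^ (η - (‖α‖ - α.re + 1))) := by
  obtain ⟨C, hC, h⟩ := corollary1_general k hk α hα0 hα
  exact ⟨C, hC, fun η f fhat _ hM => h η f fhat fun _ => hM⟩
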